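/- All graphs are finite, undirected and simple. Let $M$ be a matching of a graph $G$. A path or walk is *$M$-alternating* if, of any two consecutive edges, exactly one is in $M$; an *$mm$-$M$-path* is an $M$-alternating path whose first and last edges are in $M$ (in particular it has at least one edge). An *$M$-blossom* is an odd cycle of length $2k+1$ in $G$, exactly $k$ of whose edges are in $M$; its *base* is the vertex of the cycle that is not covered by these $k$ edges. An *$M$-flower* consists of an $M$-blossom and an $M$-alternating path of even length (possibly zero) from the base of the blossom to a vertex not saturated by $M$, the base being the only common vertex of the path and the blossom. An *$M$-posy* consists of two $M$-blossoms joined by an $mm$-$M$-path whose endpoints are the bases of the two blossoms and none of whose internal vertices lies in either blossom, where the intersection of the two blossoms (as subgraphs) is either empty or an $mm$-$M$-path. Let $SD(G)$ be the set of vertices $v$ of $G$ such that, for some maximum matching $M$ of $G$, $v$ lies in an $M$-flower or in an $M$-posy, and let $KE(G)=V(G)\setminus SD(G)$. The graph $G$ is a *Sterboul--Deming graph* if $KE(G)=\emptyset$. A *Sachs subgraph* of a graph is a spanning subgraph each of whose components is a $K_2$ or a cycle. The graph $G$ is *$k$-Sachs critical* if $G-S$ has a Sachs subgraph for every $S\subseteq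 V(G)$ with $|S|=k$. **Theorem.** Let $G$ be a graph with a perfect matching. Then $G$ is a Sterboul--Deming graph if and only if $G$ is $1$-Sachs critical. -/

import Mathlib

namespace SterboulDeming

open SimpleGraph

variable {V : Type*} {G : SimpleGraph V}

/-- A matching of `G` with the largest possible number of edges (for finite `G`). -/
def IsMaximumMatching (M : G.Subgraph) : Prop :=
  M.IsMatching ∧ ∀ N : G.Subgraph, N.IsMatching → N.edgeSet.ncard ≤ M.edgeSet.ncard

/-- Of any two consecutive edges of the walk, exactly one belongs to `M`. -/
def IsAlternatingWalk (M : G.Subgraph) {u v : V} (p : G.Walk u v) : Prop :=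
  p.edges.IsChain fun e f => Xor (e ∈ M.edgeSet) (f ∈ M.edgeSet)

/-- An alternating path whose first and last edges exist and belong to `M`. -/
def IsMMPath (M : G.Subgraph) {u v : V} (p : G.Walk u v) : Prop :=
  p.IsPath ∧ IsAlternatingWalk M p ∧
    (∃ e ∈ p.edges.head?, e ∈ M.edgeSet) ∧ (∃ e ∈ p.edges.getLast?, e ∈ M.edgeSet)

/-- An `M`-blossom with base `b`: an odd cycle of length `2k + 1`, `k` of whose edges are in `M`,
traversed from its vertex `b` that is not covered by these `k` edges. -/
def IsBlossom (M : G.Subgraph) {b : V} (c : G.Walk b b) : Prop :=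
  c.IsCycle ∧
    (∃ k : ℕ, c.length = 2 * k + 1 ∧ {e | e ∈ c.edges ∧ e ∈ M.edgeSet}.ncard = k) ∧
    ∀ e ∈ c.edges, b ∈ e → e ∉ M.edgeSet

/-- An `M`-flower: a blossom `c` with base `b`, and a stem `p`, which is an alternating path of
even length (possibly zero) from `b` to a vertex `r` not saturated by `M`, such that `b` is the
only common vertex of blossom and stem. -/
def IsFlower (M : G.Subgraph) {b r : V} (c : G.Walk b b) (p : G.Walk b r) : Prop :=
  IsBlossom M c ∧ p.IsPath ∧ IsAlternatingWalk M p ∧ Even p.length ∧ r ∉ M.support ∧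
    ∀ x, x ∈ c.support → x ∈ p.support → x = b

/-- An `M`-posy: two blossoms `c₁`, `c₂` joined by an mm-path `p` between their bases that has no
internal vertex in the blossoms, where the intersection of the blossoms (as subgraphs) is empty or
is itself an mm-path. -/
def IsPosy (M : G.Subgraph) {b₁ b₂ : V} (c₁ : G.Walk b₁ b₁) (c₂ : G.Walk b₂ b₂)
    (p : G.Walk b₁ b₂) : Prop :=
  IsBlossom M c₁ ∧ IsBlossom M c₂ ∧ IsMMPath M p ∧
    (∀ x ∈ p.support, x ≠ b₁ → x ≠ b₂ → x ∉ c₁.support ∧ x ∉ c₂.support) ∧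
    (c₁.toSubgraph ⊓ c₂.toSubgraph = ⊥ ∨
      ∃ (x y : V) (q : G.Walk x y), IsMMPath M q ∧ c₁.toSubgraph ⊓ c₂.toSubgraph = q.toSubgraph)

/-- `SD(G)`: the vertices that lie in a flower or a posy with respect to some maximum matching. -/
def SD (G : SimpleGraph V) : Set V :=
  {v | ∃ M : G.Subgraph, IsMaximumMatching M ∧
    ((∃ (b r : V) (c : G.Walk b b) (p : G.Walk b r),
        IsFlower M c p ∧ (v ∈ c.support ∨ v ∈ p.support)) ∨
      ∃ (b₁ b₂ : V) (c₁ : G.Walk b₁ b₁) (c₂ : G.Walk b₂ b₂) (p : G.Walk b₁ b₂),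
        IsPosy M c₁ c₂ p ∧ (v ∈ c₁.support ∨ v ∈ c₂.support ∨ v ∈ p.support))}

/-- `KE(G)`: the complement of `SD(G)`. -/
def KE (G : SimpleGraph V) : Set V := (SD G)ᶜ

/-- `G` is a Sterboul–Deming graph if `KE(G)` is empty. -/
def IsSterboulDeming (G : SimpleGraph V) : Prop := KE G = ∅

/-- `S` is a Sachs subgraph of `G`: a spanning subgraph (same vertex type, `S ≤ G`), each of whose
components is isomorphic to `K₂` or to a cycle. -/
def IsSachsSubgraph {W : Type*} (G S : SimpleGraph W) : Prop :=
  S ≤ G ∧ ∀ C : S.ConnectedComponent,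
    Nonempty (C.toSimpleGraph ≃g (completeGraph (Fin 2))) ∨
      ∃ n : ℕ, 3 ≤ n ∧ Nonempty (C.toSimpleGraph ≃g cycleGraph n)

/-- `G` is `k`-Sachs critical if `G - S` has a Sachs subgraph for every vertex set `S` with
`|S| = k`. -/
def IsSachsCritical (k : ℕ) (G : SimpleGraph V) : Prop :=
  ∀ S : Finset V, S.card = k →
    ∃ H : SimpleGraph ((S : Set V)ᶜ : Set V), IsSachsSubgraph (G.induce (S : Set V)ᶜ) H

end SterboulDeming

/-! Both properties are equivalent to one criterion, `IsBicritical`: every nonempty independent set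
has more neighbours than elements.

Sachs side. A Sachs subgraph amounts to an injective map sending each vertex to a neighbour, its
components being the orbits. For G - v, Hall's theorem decides whether such a map exists, and a
violating set X yields the independent set X \ N(X), which has too few neighbours in G even when v
is counted.

Sterboul–Deming implies the criterion. If an independent set I has at most |I| neighbours, every
perfect matching pairs I with N(I), so the partner of any neighbour of I is again in I. Following
this rule along the blossoms and the path of a posy puts some vertex and its partner both in I,
which is absurd. So I avoids every posy, and a perfect matching has no flowers.

The criterion implies Sterboul–Deming. The matching is forgotten at first: a posy shape
(`IsPosyShape`) consists of two odd cycles joined by an odd path, or is a subdivision of K₄ with six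
odd links. If the remaining vertices can be perfectly matched (`Nice`), a matching can be chosen
that turns the shape into a posy. An odd link has an even interior, matched along the link, so
pieces cut off by surgery can be returned to the complement. The engine is `IsBicritical.explore`:
an alternating search that got stuck would have reached an independent set violating the criterion.
Starting from one edge, searches produce two joined odd cycles or an even cycle with an odd chord
(`Theta`). A search on the latter gives a posy shape or a shorter chord. Finally
`IsBicritical.inPosyShape_of_adj` spreads posy shapes to all neighbours, hence over each component:
a search from a vertex next to the shape yields an odd ear or a pendant odd cycle, and
`IsPosyShape.extendsBy` and `IsPosyShape.extendsBy_lollipop` absorb it. -/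

namespace SterboulDeming

open SimpleGraph

variable {V : Type*} {G : SimpleGraph V}

/-! ### Walks of given parity and their vertex multisets. -/

/-- `OddLink G a S b`: a walk of odd length from `a` to `b` whose internal vertices, listed with
multiplicity, form `S`. -/
inductive OddLink (G : SimpleGraph V) : V → Multiset V → V → Prop
  | edge {a b : V} : G.Adj a b → OddLink G a 0 b
  | cons {a x y b : V} {S : Multiset V} :
      G.Adj a x → G.Adj x y → OddLink G y S b → OddLink G a ({x} + {y} + S) b

/-- `EvenLink G a S b`: a walk of even length from `a` to `b` whose vertices other than the final
`b`, listed with multiplicity, form `S`. -/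
inductive EvenLink (G : SimpleGraph V) : V → Multiset V → V → Prop
  | refl (a : V) : EvenLink G a 0 a
  | cons {a x y b : V} {S : Multiset V} :
      G.Adj a x → G.Adj x y → EvenLink G y S b → EvenLink G a ({a} + {x} + S) b

/-- `S` can be partitioned into pairs of adjacent vertices. -/
inductive Matched (G : SimpleGraph V) : Multiset V → Prop
  | zero : Matched G 0
  | pair {x y : V} {S : Multiset V} : G.Adj x y → Matched G S → Matched G ({x} + {y} + S)

theorem Matched.add {S T : Multiset V} (hS : Matched G S) (hT : Matched G T) :
    Matched G (S + T) := by
  induction hS with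
  | zero => simpa using hT
  | pair h _ ih => rw [add_assoc]; exact .pair h ih

theorem Matched.exists_partner {S : Multiset V} (hS : Matched G S) {v : V} (hv : v ∈ S) :
    ∃ w T, G.Adj v w ∧ Matched G T ∧ S = {v} + {w} + T := by
  induction hS with
  | zero => simp at hv
  | @pair x y S h hS ih =>
    simp only [Multiset.mem_add, Multiset.mem_singleton] at hv
    rcases hv with (rfl | rfl) | hv
    · exact ⟨y, S, h, hS, rfl⟩
    · exact ⟨x, S, h.symm, hS, by abel⟩
    · obtain ⟨w, T, h1, h2, rfl⟩ := ih hv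
      exact ⟨w, {x} + {y} + T, h1, .pair h h2, by abel⟩

theorem OddLink.snoc {a b x y : V} {S : Multiset V} (h : OddLink G a S b) (hx : G.Adj b x)
    (hy : G.Adj x y) : OddLink G a (S + {b} + {x}) y := by
  induction h with
  | edge h => simpa using OddLink.cons h hx (.edge hy)
  | cons h1 h2 _ ih => simpa only [add_assoc] using OddLink.cons h1 h2 (ih hx)

theorem OddLink.symm {a b : V} {S : Multiset V} (h : OddLink G a S b) : OddLink G b S a := by
  induction h with
  | edge h => exact .edge h.symm
  | @cons a x y b S h1 h2 _ ih =>
    have := ih.snoc h2.symm h1.symm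
    rwa [show S + {y} + {x} = {x} + {y} + S by abel] at this

theorem OddLink.append_edge {a b c d : V} {S T : Multiset V} (h : OddLink G a S b)
    (h' : G.Adj b c) (h'' : OddLink G c T d) : OddLink G a (S + {b} + {c} + T) d := by
  induction h with
  | edge h => simpa using OddLink.cons h h' h''
  | cons h1 h2 _ ih => simpa only [add_assoc] using OddLink.cons h1 h2 (ih h')

theorem OddLink.trans₃ {a b c d : V} {S T U : Multiset V} (h : OddLink G a S b)
    (h' : OddLink G b T c) (h'' : OddLink G c U d) :
    OddLink G a (S + {b} + T + {c} + U) d := by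
  induction h' generalizing a S with
  | edge h1 => simpa using h.append_edge h1 h''
  | @cons b x y c T h1 h2 _ ih =>
    have := ih (h.snoc h1 h2) h''
    rwa [show S + {b} + {x} + {y} + T + {c} + U = S + {b} + ({x} + {y} + T) + {c} + U by abel]
      at this

theorem OddLink.matched {a b : V} {S : Multiset V} (h : OddLink G a S b) : Matched G S := by
  induction h with
  | edge _ => exact .zero
  | cons _ h2 _ ih => exact .pair h2 ih

theorem OddLink.matched_ends {a b : V} {S : Multiset V} (h : OddLink G a S b) :
    Matched G ({a} + S + {b}) := by
  induction h with
  | @edge a b h => simpa using Matched.pair h .zero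
  | @cons a x y b S h1 _ _ ih =>
    rw [show {a} + ({x} + {y} + S) + {b} = {a} + {x} + ({y} + S + {b}) by abel]
    exact .pair h1 ih

theorem OddLink.exists_first {a b : V} {S : Multiset V} (h : OddLink G a S b) :
    ∃ x T, G.Adj a x ∧ Matched G T ∧ S + {b} = {x} + T := by
  cases h with
  | edge h => exact ⟨b, 0, h, .zero, by simp⟩
  | @cons _ x y _ S h1 h2 h3 =>
    exact ⟨x, {y} + S + {b}, h1, h3.matched_ends, by abel⟩

theorem OddLink.reachable {a b : V} {S : Multiset V} (h : OddLink G a S b) :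
    G.Reachable a b := by
  induction h with
  | edge h => exact h.reachable
  | cons h1 h2 _ ih => exact h1.reachable.trans (h2.reachable.trans ih)

theorem EvenLink.matched {a b : V} {S : Multiset V} (h : EvenLink G a S b) : Matched G S := by
  induction h with
  | refl => exact .zero
  | cons h1 _ _ ih => exact .pair h1 ih

theorem EvenLink.reachable {a b : V} {S : Multiset V} (h : EvenLink G a S b) :
    G.Reachable a b := by
  induction h with
  | refl => exact .rfl
  | cons h1 h2 _ ih => exact h1.reachable.trans (h2.reachable.trans ih)

theorem EvenLink.trans {a b c : V} {S T : Multiset V} (h : EvenLink G a S b)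
    (h' : EvenLink G b T c) : EvenLink G a (S + T) c := by
  induction h with
  | refl => simpa using h'
  | cons h1 h2 _ ih => rw [add_assoc]; exact .cons h1 h2 (ih h')

theorem EvenLink.symm {a b : V} {S : Multiset V} (h : EvenLink G a S b) :
    ∃ T, EvenLink G b T a ∧ S + {b} = T + {a} := by
  induction h with
  | refl a => exact ⟨0, .refl a, rfl⟩
  | @cons a x y b S h1 h2 _ ih =>
    obtain ⟨T, hT, e⟩ := ih
    refine ⟨T + ({y} + {x}), hT.trans (by simpa using EvenLink.cons h2.symm h1.symm (.refl a)), ?_⟩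
    rw [add_assoc, e]; abel

/-- An odd link extended at its beginning by an even link. -/
theorem EvenLink.oddLink {a u d : V} {S T : Multiset V} (h : EvenLink G a S u)
    (h' : OddLink G a T d) : OddLink G u (S + T) d := by
  induction h generalizing T with
  | refl => simpa using h'
  | @cons a x y b S h1 h2 _ ih =>
    have := ih (OddLink.cons h2.symm h1.symm h')
    rwa [show S + ({x} + {a} + T) = {a} + {x} + S + T by abel] at this

/-- Two odd links make an even link. -/
theorem OddLink.evenLink {a b c : V} {S T : Multiset V} (h : OddLink G a S b)
    (h' : OddLink G b T c) : EvenLink G a ({a} + S + {b} + T) c := by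
  induction h with
  | @edge a b h =>
    induction h' generalizing a with
    | edge h1 => simpa using EvenLink.cons h h1 (.refl _)
    | @cons b x y c T h1 h2 _ ih =>
      have := EvenLink.cons h h1 (ih h2)
      rwa [show {a} + {b} + ({x} + 0 + {y} + T) = {a} + 0 + {b} + ({x} + {y} + T) by abel] at this
  | @cons a x y b S h1 h2 _ ih =>
    have := EvenLink.cons h1 h2 (ih h')
    rwa [show {a} + {x} + ({y} + S + {b} + T) = {a} + ({x} + {y} + S) + {b} + T by abel] at this

/-- A vertex of an odd link is at even distance along the link from exactly one end; this is the
case that the end is the first vertex. -/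
theorem OddLink.split {a b : V} {L : Multiset V} (h : OddLink G a L b) {x : V}
    (hx : x ∈ {a} + L + {b}) :
    (∃ A B, EvenLink G a A x ∧ OddLink G x B b ∧ {a} + L = A + {x} + B) ∨
      ∃ A B, EvenLink G b A x ∧ OddLink G x B a ∧ {b} + L = A + {x} + B := by
  induction h with
  | @edge a b h =>
    simp only [add_zero, Multiset.mem_add, Multiset.mem_singleton] at hx
    rcases hx with rfl | rfl
    · exact .inl ⟨0, 0, .refl _, .edge h, by simp⟩
    · exact .inr ⟨0, 0, .refl _, .edge h.symm, by simp⟩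
  | @cons a p q b S h1 h2 h3 ih =>
    by_cases hxa : x = a
    · subst hxa
      exact .inl ⟨0, _, .refl _, .cons h1 h2 h3, by simp⟩
    by_cases hxp : x = p
    · subst hxp
      obtain ⟨T, hT, e⟩ := (OddLink.evenLink (.edge h2) h3).symm
      refine .inr ⟨T, 0, hT, .edge h1.symm, ?_⟩
      rw [add_zero, ← e]; abel
    · have : x ∈ {q} + S + {b} := by
        simp only [Multiset.mem_add, Multiset.mem_singleton] at hx ⊢; tauto
      rcases ih this with ⟨A, B, hA, hB, e⟩ | ⟨A, B, hA, hB, e⟩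
      · refine .inl ⟨_, B, .cons h1 h2 hA, hB, ?_⟩
        rw [show {a} + ({p} + {q} + S) = {a} + {p} + ({q} + S) by abel, e]; abel
      · refine .inr ⟨A, _, hA, hB.snoc h2.symm h1.symm, ?_⟩
        rw [show {b} + ({p} + {q} + S) = {p} + {q} + ({b} + S) by abel, e]; abel

theorem EvenLink.split {a b : V} {L : Multiset V} (h : EvenLink G a L b) {x : V} (hx : x ∈ L) :
    (∃ A B, EvenLink G a A x ∧ EvenLink G x B b ∧ L = A + B) ∨
      ∃ A B, OddLink G a A x ∧ OddLink G x B b ∧ L = {a} + A + {x} + B := by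
  induction h with
  | refl => simp at hx
  | @cons a p q b S h1 h2 h3 ih =>
    by_cases hxa : x = a
    · subst hxa
      exact .inl ⟨0, _, .refl _, .cons h1 h2 h3, by simp⟩
    by_cases hxp : x = p
    · subst hxp
      obtain ⟨T, hT, e⟩ := h3.symm
      refine .inr ⟨0, S, .edge h1, ?_, by abel⟩
      simpa using (h3.oddLink (.edge h2.symm)).symm
    · have : x ∈ S := by
        simp only [Multiset.mem_add, Multiset.mem_singleton] at hx; tauto
      rcases ih this with ⟨A, B, hA, hB, e⟩ | ⟨A, B, hA, hB, e⟩
      · exact .inl ⟨_, B, .cons h1 h2 hA, hB, by rw [e]; abel⟩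
      · exact .inr ⟨_, B, .cons h1 h2 hA, hB, by rw [e]; abel⟩

/-- Here u is at even distance from a. If the piece of the link between u and s is odd, `R` can
replace it and its interior D is released; if it is even, it closes an odd cycle with `R`. -/
theorem OddLink.split₂_aux {a b : V} {L : Multiset V} {u s : V}
    (hs : s ∈ {a} + L + {b}) {R A B : Multiset V} (hR : OddLink G u R s) (hA : EvenLink G a A u)
    (hB : OddLink G u B b) (e : {a} + L = A + {u} + B) :
    (∃ L' D, OddLink G a (L' + R) b ∧ Matched G D ∧ L = L' + D) ∨
      ∃ x y A C B, EvenLink G a A x ∧ EvenLink G x C y ∧ OddLink G y B b ∧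
        OddLink G x R y ∧ {a} + L = A + C + {y} + B := by
  rw [e] at hs
  by_cases hsA : s ∈ A
  · rcases hA.split hsA with ⟨A1, A2, h1, h2, rfl⟩ | ⟨A1, A2, h1, h2, rfl⟩
    · exact .inr ⟨s, u, A1, A2, B, h1, h2, hB, hR.symm, e⟩
    · refine .inl ⟨A1 + {s} + {u} + B, A2, ?_, h2.matched, ?_⟩
      · have := h1.trans₃ hR.symm hB
        rwa [show A1 + {s} + R + {u} + B = A1 + {s} + {u} + B + R by abel] at this
      · apply add_left_cancel (a := {a})
        rw [e]; abel
  · have hsB : s ∈ {u} + B + {b} := by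
      simp only [Multiset.mem_add, Multiset.mem_singleton] at hs ⊢; tauto
    rcases hB.split hsB with ⟨A', B', h1, h2, e'⟩ | ⟨A', B', h1, h2, e'⟩
    · refine .inr ⟨u, s, A, A', B', hA, h1, h2, hR, ?_⟩
      rw [e, add_assoc, e']; abel
    · obtain ⟨A'', h3, e3⟩ := h1.symm
      obtain ⟨A2, h4, e4⟩ := hA.symm
      refine .inl ⟨A2 + A'', B', ?_, h2.matched, ?_⟩
      · have := h4.oddLink (h3.oddLink hR.symm).symm
        rwa [← add_assoc] at this
      · have e5 : B = A'' + B' := by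
          apply add_left_cancel (a := {b})
          rw [e', e3]; abel
        apply add_left_cancel (a := {a})
        rw [e, e4, e5]; abel

/-- Two vertices on an odd link, joined by a further odd link `R`: either `R` replaces a piece of
odd length, or it closes an odd cycle with a piece of even length. -/
theorem OddLink.split₂ {a b : V} {L : Multiset V} (h : OddLink G a L b) {u s : V}
    (hu : u ∈ {a} + L + {b}) (hs : s ∈ {a} + L + {b}) {R : Multiset V} (hR : OddLink G u R s) :
    (∃ L' D, OddLink G a (L' + R) b ∧ Matched G D ∧ L = L' + D) ∨
      (∃ x y A C B, EvenLink G a A x ∧ EvenLink G x C y ∧ OddLink G y B b ∧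
        OddLink G x R y ∧ {a} + L = A + C + {y} + B) ∨
      ∃ x y A C B, EvenLink G b A x ∧ EvenLink G x C y ∧ OddLink G y B a ∧
        OddLink G x R y ∧ {b} + L = A + C + {y} + B := by
  rcases h.split hu with ⟨A, B, hA, hB, e⟩ | ⟨A, B, hA, hB, e⟩
  · rcases OddLink.split₂_aux hs hR hA hB e with h1 | h1
    · exact .inl h1
    · exact .inr (.inl h1)
  · rw [show {a} + L + {b} = {b} + L + {a} by abel] at hs
    rcases OddLink.split₂_aux hs hR hA hB e with ⟨L', D, h1, h2, h3⟩ | h1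
    · exact .inl ⟨L', D, h1.symm, h2, h3⟩
    · exact .inr (.inr h1)

/-- `OddLink.split`, with the even piece directed towards the end of the link. -/
theorem OddLink.split' {a b : V} {L : Multiset V} (h : OddLink G a L b) {x : V}
    (hx : x ∈ {a} + L + {b}) :
    (∃ A B, EvenLink G x A a ∧ OddLink G x B b ∧ L = A + B) ∨
      ∃ A B, EvenLink G x A b ∧ OddLink G x B a ∧ L = A + B := by
  rcases h.split hx with ⟨A, B, hA, hB, e⟩ | ⟨A, B, hA, hB, e⟩ <;>
  · obtain ⟨A', hA', e'⟩ := hA.symm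
    rw [e'] at e
    have : L = A' + B := by
      apply add_left_cancel (a := {_})
      rw [e, add_right_comm, add_comm]
    first
    | exact .inl ⟨A', B, hA', hB, this⟩
    | exact .inr ⟨A', B, hA', hB, this⟩

/-! ### The criterion, and vertex sets with matchable complement. -/

/-- Every nonempty independent set has more neighbours than elements. -/
def IsBicritical [Fintype V] (G : SimpleGraph V) : Prop :=
  ∀ I : Finset V, I.Nonempty → (∀ x ∈ I, ∀ y ∈ I, ¬ G.Adj x y) →
    ∀ N : Finset V, (∀ x ∈ I, ∀ y, G.Adj x y → y ∈ N) → I.card < N.card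

/-- The vertices outside `S` can be partitioned into adjacent pairs, and `S` has no repetition. -/
def Nice [Fintype V] (G : SimpleGraph V) (S : Multiset V) : Prop :=
  ∃ R, Matched G R ∧ S + R = Finset.univ.val

/-- Every surgery disposes of its leftover pieces in this way. -/
theorem Nice.of_add [Fintype V] {S D : Multiset V} (h : Nice G (S + D)) (hD : Matched G D) :
    Nice G S := by
  obtain ⟨R, hR, e⟩ := h
  exact ⟨D + R, hD.add hR, by rw [← e, add_assoc]⟩

/-- Links are mere walks; all disjointness and simplicity is recovered from here, by comparison with
`Finset.univ`. -/
theorem Nice.nodup [Fintype V] {S : Multiset V} (h : Nice G S) : S.Nodup := by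
  obtain ⟨R, hR, e⟩ := h
  have := Finset.univ.nodup (α := V)
  rw [← e] at this
  exact (Multiset.nodup_add.1 this).1

/-- `m` is a perfect matching of the vertices in `R`, as an involution. -/
def IsPartner (G : SimpleGraph V) (m : V → V) (R : Multiset V) : Prop :=
  ∀ x ∈ R, m x ∈ R ∧ G.Adj x (m x) ∧ m (m x) = x

theorem IsPartner.mono {m : V → V} {R P : Multiset V} (h : IsPartner G m R)
    (hP : ∀ x ∈ P, x ∈ R ∧ m x ∈ P) : IsPartner G m P :=
  fun x hx ↦ ⟨(hP x hx).2, (h x (hP x hx).1).2⟩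

theorem Matched.exists_isPartner {R : Multiset V} (h : Matched G R) (hR : R.Nodup) :
    ∃ m, IsPartner G m R := by
  classical
  induction h with
  | zero => exact ⟨id, by simp [IsPartner]⟩
  | @pair x y S h _ ih =>
    rw [Multiset.nodup_add] at hR
    obtain ⟨-, hS, hd⟩ := hR
    obtain ⟨m, hm⟩ := ih hS
    have hx : x ∉ S := fun hx ↦ (Multiset.disjoint_left.1 hd (by simp)) hx
    have hy : y ∉ S := fun hy ↦ (Multiset.disjoint_left.1 hd (by simp)) hy
    refine ⟨fun z ↦ if z = x then y else if z = y then x else m z, fun z hz ↦ ?_⟩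
    simp only [Multiset.mem_add, Multiset.mem_singleton] at hz
    rcases hz with (rfl | rfl) | hz
    · simp [h, h.ne']
    · simp [h.symm, h.ne']
    · have h1 : z ≠ x := by rintro rfl; exact hx hz
      have h2 : z ≠ y := by rintro rfl; exact hy hz
      obtain ⟨h3, h4, h5⟩ := hm z hz
      have h6 : m z ≠ x := by intro h; exact hx (h ▸ h3)
      have h7 : m z ≠ y := by intro h; exact hy (h ▸ h3)
      simp [h1, h2, h3, h4, h5, h6, h7]

theorem IsPartner.matched {m : V → V} {R : Multiset V} (h : IsPartner G m R) (hR : R.Nodup) :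
    Matched G R := by
  classical
  induction hn : R.card using Nat.strong_induction_on generalizing R with
  | _ n ih =>
    rcases R.empty_or_exists_mem with rfl | ⟨x, hx⟩
    · exact .zero
    obtain ⟨h1, h2, h3⟩ := h x hx
    obtain ⟨S, rfl⟩ := Multiset.exists_cons_of_mem hx
    have h4 : m x ∈ S := (Multiset.mem_cons.1 h1).resolve_left h2.ne'
    obtain ⟨T, rfl⟩ := Multiset.exists_cons_of_mem h4
    simp only [Multiset.nodup_cons, Multiset.mem_cons, not_or] at hR
    have := ih T.card (by rw [← hn]; simp) (h.mono fun y hy ↦ ⟨by simp [hy], ?_⟩) hR.2.2 rfl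
    · rw [← Multiset.singleton_add, ← Multiset.singleton_add, ← add_assoc]
      exact .pair h2 this
    · obtain ⟨h5, h6, h7⟩ := h y (by simp [hy])
      simp only [Multiset.mem_cons] at h5
      rcases h5 with h5 | h5 | h5
      · exact absurd (by rw [← h7, h5]) (fun e : y = m x ↦ hR.2.1 (e ▸ hy))
      · have : y = x := by rw [← h7, h5, h3]
        exact absurd hy (this ▸ hR.1.2)
      · exact h5

/-! ### Alternating search. -/

/-- `Alternating G m R w z P`: an alternating path from `w` to `z`, consisting of pairs of vertices
in `R` matched by `m`, with `P` the vertices other than `w`. -/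
inductive Alternating (G : SimpleGraph V) (m : V → V) (R : Multiset V) (w : V) :
    V → Multiset V → Prop
  | refl : Alternating G m R w w 0
  | snoc {z y : V} {P : Multiset V} : Alternating G m R w z P → G.Adj z y → y ∈ R → y ∉ P →
      Alternating G m R w (m y) ({m y} + {y} + P)

namespace Alternating

variable {m : V → V} {R P : Multiset V} {w z : V}

theorem evenLink (hm : IsPartner G m R) (h : Alternating G m R w z P) : EvenLink G z P w := by
  induction h with
  | refl => exact .refl _
  | snoc _ h1 h2 _ ih => exact .cons (hm _ h2).2.1.symm h1.symm ih

theorem closed (hm : IsPartner G m R) (h : Alternating G m R w z P) :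
    P.Nodup ∧ ∀ x ∈ P, x ∈ R ∧ m x ∈ P := by
  induction h with
  | refl => simp
  | @snoc z y P _ _ h2 h3 ih =>
    obtain ⟨h4, h5, h6⟩ := hm y h2
    refine ⟨?_, ?_⟩
    · have h7 : m y ∉ P := fun h ↦ h3 (h6 ▸ (ih.2 _ h).2)
      rw [add_assoc, Multiset.singleton_add, Multiset.singleton_add]
      simp [h3, h7, h5.ne', ih.1]
    · intro x hx
      simp only [Multiset.mem_add, Multiset.mem_singleton] at hx ⊢
      rcases hx with (rfl | rfl) | hx
      · exact ⟨h4, .inl (.inr h6)⟩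
      · exact ⟨h2, .inl (.inl rfl)⟩
      · exact ⟨(ih.2 x hx).1, .inr (ih.2 x hx).2⟩

theorem eq_or_mem (h : Alternating G m R w z P) : z = w ∨ z ∈ P := by
  cases h with
  | refl => exact .inl rfl
  | snoc => simp

/-- A vertex of an alternating path, or its partner, is reached by a part of the path. -/
theorem split (hm : IsPartner G m R) (h : Alternating G m R w z P) {y : V} (hy : y ∈ P) :
    (∃ P₁ P₂, EvenLink G y P₁ w ∧ EvenLink G z P₂ y ∧ P = P₁ + P₂) ∨
      ∃ P₁, Alternating G m R w (m y) P₁ := by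
  induction h with
  | refl => simp at hy
  | @snoc z x P h h1 h2 h3 ih =>
    by_cases hyx : y = x
    · subst hyx; exact .inr ⟨_, .snoc h h1 h2 h3⟩
    by_cases hym : y = m x
    · subst hym
      exact .inl ⟨_, 0, (h.snoc h1 h2 h3).evenLink hm, .refl _, by simp⟩
    · have hy : y ∈ P := by
        simp only [Multiset.mem_add, Multiset.mem_singleton] at hy; tauto
      rcases ih hy with ⟨P₁, P₂, h4, h5, rfl⟩ | h4
      · exact .inl ⟨P₁, _, h4, .cons (hm _ h2).2.1.symm h1.symm h5, by abel⟩
      · exact .inr h4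

end Alternating

/-- Alternating search from the vertices `Wh`, whose partners in a partial structure
`Wh + Bl + Y` are outnumbered or balanced: it finds an odd cycle, or an odd path back to the
structure that avoids `Bl`. -/
theorem IsBicritical.explore [Fintype V] (hG : IsBicritical G) {Wh Bl Y : Multiset V}
    (hN : Nice G (Wh + Bl + Y)) (hc : Bl.card ≤ Wh.card) (hne : Wh ≠ 0) :
    ∃ w ∈ Wh, (∃ z T C, EvenLink G z T w ∧ OddLink G z C z ∧ Nice G (Wh + Bl + Y + (T + C))) ∨
      ∃ x ∈ Wh + Y, x ≠ w ∧ ∃ R, OddLink G w R x ∧ Nice G (Wh + Bl + Y + R) := by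
  classical
  have hnd := hN.nodup
  obtain ⟨R, hR, e⟩ := hN
  have huniv : (Wh + Bl + Y + R).Nodup := e ▸ Finset.univ.nodup
  have hmem : ∀ x, x ∈ Wh + Bl + Y + R := fun x ↦ e ▸ Finset.mem_univ x
  obtain ⟨m, hm⟩ := hR.exists_isPartner (Multiset.nodup_add.1 huniv).2.1
  have hdisj := (Multiset.nodup_add.1 huniv).2.2
  have hWR : ∀ x ∈ Wh, x ∉ R := fun x hx ↦ Multiset.disjoint_left.1 hdisj (by simp [hx])
  have hWB : ∀ x ∈ Wh, x ∉ Bl := fun x hx ↦ Multiset.disjoint_left.1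
    (Multiset.nodup_add.1 (Multiset.nodup_add.1 hnd).1).2.2 hx
  have hBR : ∀ x ∈ Bl, x ∉ R := fun x hx ↦ Multiset.disjoint_left.1 hdisj (by simp [hx])
  by_contra! hcon
  -- The path interior P is closed under `m`, so `m` still matches what is left of R.
  have hnice : ∀ {w z : V} {P : Multiset V}, Alternating G m R w z P →
      Nice G (Wh + Bl + Y + P) := by
    intro w z P h
    obtain ⟨h1, h2⟩ := h.closed hm
    have hle : P ≤ R := (Multiset.le_iff_subset h1).2 fun x hx ↦ (h2 x hx).1
    obtain ⟨Q, rfl⟩ := Multiset.le_iff_exists_add.1 hle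
    refine ⟨Q, ?_, by rw [← e]; abel⟩
    have hPQ := Multiset.nodup_add.1 (Multiset.nodup_add.1 huniv).2.1
    refine (hm.mono fun x hx ↦ ⟨by simp [hx], ?_⟩).matched hPQ.2.1
    obtain ⟨h3, h4, h5⟩ := hm x (by simp [hx])
    refine (Multiset.mem_add.1 h3).resolve_left fun h6 ↦ ?_
    have := (h2 _ h6).2
    rw [h5] at this
    exact Multiset.disjoint_left.1 hPQ.2.2 this hx
  let I : Finset V := Finset.univ.filter fun z ↦ ∃ w ∈ Wh, ∃ P, Alternating G m R w z P
  have hI : ∀ {z}, z ∈ I ↔ ∃ w ∈ Wh, ∃ P, Alternating G m R w z P := by simp [I]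
  have hWI : ∀ x ∈ Wh, x ∈ I := fun x hx ↦ hI.2 ⟨x, hx, 0, .refl⟩
  have hIR : ∀ x ∈ I, x ∈ Wh ∨ x ∈ R := by
    intro x hx
    obtain ⟨w, hw, P, h⟩ := hI.1 hx
    rcases h.eq_or_mem with rfl | h'
    · exact .inl hw
    · exact .inr ((h.closed hm).2 x h').1
  -- closure of the search
  have hclosure : ∀ z ∈ I, ∀ y, G.Adj z y → y ∈ Bl ∨ y ∈ R ∧ m y ∈ I := by
    intro z hz y hzy
    obtain ⟨w, hw, P, h⟩ := hI.1 hz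
    have hy := hmem y
    simp only [Multiset.mem_add] at hy
    -- Meeting `Wh + Y` is one of the two excluded outcomes; a return to `w` itself is an odd cycle
    -- with empty stem.
    have hback : y ∉ Wh + Y := by
      intro hy
      by_cases hyw : y = w
      · subst hyw
        refine (hcon y hw).1 y 0 P (.refl _) ?_ (by simpa using hnice h)
        simpa using (h.evenLink hm).oddLink (.edge hzy)
      · refine (hcon w hw).2 y hy hyw P ?_ (hnice h)
        simpa using (h.evenLink hm).oddLink (.edge hzy)
    simp only [Multiset.mem_add, not_or] at hback
    rcases hy with ((hy | hy) | hy) | hy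
    · exact absurd hy hback.1
    · exact .inl hy
    · exact absurd hy hback.2
    · refine .inr ⟨hy, hI.2 ?_⟩
      -- If y is already on the path, either y is itself reached by an initial part of it, so that
      -- the edge zy closes an odd cycle, or an initial part already ends at `m y`.
      by_cases hyP : y ∈ P
      · rcases h.split hm hyP with ⟨P₁, P₂, h1, h2, rfl⟩ | ⟨P₁, h1⟩
        · refine absurd (hnice h) ((hcon w hw).1 y P₁ P₂ h1 ?_)
          simpa using h2.oddLink (.edge hzy)
        · exact ⟨w, hw, P₁, h1⟩
      · exact ⟨w, hw, _, h.snoc hzy hy hyP⟩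
  -- If a vertex and its partner were both reached, closure at the partner would give the same
  -- situation one pair earlier on the path, and so on back to `Wh`, which is disjoint from R.
  have hpair : ∀ {w z : V} {P : Multiset V}, w ∈ Wh → Alternating G m R w z P → z ∈ R →
      m z ∉ I := by
    intro w z P hw h
    induction h with
    | refl => exact fun h ↦ absurd h (hWR w hw)
    | @snoc z y P h h1 h2 h3 ih =>
      intro _ h5
      rw [(hm y h2).2.2] at h5
      rcases hclosure y h5 z h1.symm with h6 | ⟨h6, h7⟩
      · rcases h.eq_or_mem with rfl | h8
        · exact hWB _ hw h6
        · exact hBR _ h6 ((h.closed hm).2 _ h8).1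
      · exact ih h6 h7
  have hindep : ∀ x ∈ I, ∀ y ∈ I, ¬ G.Adj x y := by
    intro x hx y hy hxy
    rcases hclosure x hx y hxy with h1 | ⟨h1, h2⟩
    · rcases hIR y hy with h3 | h3
      · exact hWB _ h3 h1
      · exact hBR _ h1 h3
    · obtain ⟨w, hw, P, h⟩ := hI.1 hy
      exact hpair hw h h1 h2
  obtain ⟨w₀, hw₀⟩ := Multiset.exists_mem_of_ne_zero hne
  -- The neighbours of I lie in Bl together with the partners of I ∩ R, so there are at most |Wh| +
  -- |I ∩ R| ≤ |I| of them, against the criterion.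
  have hlt := hG I ⟨w₀, hWI _ hw₀⟩ hindep (Bl.toFinset ∪ (I.filter (· ∈ R)).image m) (by
    intro x hx y hxy
    simp only [Finset.mem_union, Multiset.mem_toFinset, Finset.mem_image, Finset.mem_filter]
    rcases hclosure x hx y hxy with h1 | ⟨h1, h2⟩
    · exact .inl h1
    · exact .inr ⟨m y, ⟨h2, (hm y h1).1⟩, (hm y h1).2.2⟩)
  have h1 : (Bl.toFinset ∪ (I.filter (· ∈ R)).image m).card ≤ Bl.card + (I.filter (· ∈ R)).card :=
    (Finset.card_union_le _ _).trans
      (add_le_add (Multiset.toFinset_card_le _) Finset.card_image_le)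
  have hWnd : Wh.Nodup := (Multiset.nodup_add.1 (Multiset.nodup_add.1 hnd).1).1
  have h2 : Wh.card + (I.filter (· ∈ R)).card ≤ I.card := by
    rw [← Multiset.toFinset_card_of_nodup hWnd, ← Finset.card_union_of_disjoint]
    · refine Finset.card_le_card fun x hx ↦ ?_
      simp only [Finset.mem_union, Multiset.mem_toFinset, Finset.mem_filter] at hx
      rcases hx with hx | hx
      · exact hWI x hx
      · exact hx.1
    · rw [Finset.disjoint_left]
      intro x hx hx'
      simp only [Multiset.mem_toFinset, Finset.mem_filter] at hx hx'
      exact hWR x hx hx'.2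
  omega

/-! ### Posy shapes and the absorption of odd ears. -/

/-- `S` is the vertex multiset of two odd cycles joined by an odd path, or of an odd subdivision
of `K₄`. -/
inductive IsPosyShape (G : SimpleGraph V) : Multiset V → Prop
  | barbell {a b : V} {A L B : Multiset V} : OddLink G a A a → OddLink G a L b →
      OddLink G b B b → IsPosyShape G ({a} + {b} + A + L + B)
  | tetrahedron {a b c d : V} {ab ac ad bc bd cd : Multiset V} : OddLink G a ab b →
      OddLink G a ac c → OddLink G a ad d → OddLink G b bc c → OddLink G b bd d →
      OddLink G c cd d → IsPosyShape G ({a} + {b} + {c} + {d} + ab + ac + ad + bc + bd + cd)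

/-- Some part of `S` together with all of `R` is a posy shape, the rest of `S` being matched. -/
def ExtendsBy (G : SimpleGraph V) (S R : Multiset V) : Prop :=
  ∃ S' D, IsPosyShape G (S' + R) ∧ Matched G D ∧ S = S' + D

theorem extendsBy_of_barbell {a b : V} {A L B S R S' D : Multiset V} (hA : OddLink G a A a)
    (hL : OddLink G a L b) (hB : OddLink G b B b) (hD : Matched G D) (e : S = S' + D)
    (e' : S' + R = {a} + {b} + A + L + B) : ExtendsBy G S R :=
  ⟨S', D, e' ▸ .barbell hA hL hB, hD, e⟩

theorem extendsBy_of_tetrahedron {a b c d : V} {ab ac ad bc bd cd S R S' D : Multiset V}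
    (h1 : OddLink G a ab b) (h2 : OddLink G a ac c) (h3 : OddLink G a ad d)
    (h4 : OddLink G b bc c) (h5 : OddLink G b bd d) (h6 : OddLink G c cd d) (hD : Matched G D)
    (e : S = S' + D) (e' : S' + R = {a} + {b} + {c} + {d} + ab + ac + ad + bc + bd + cd) :
    ExtendsBy G S R :=
  ⟨S', D, e' ▸ .tetrahedron h1 h2 h3 h4 h5 h6, hD, e⟩

/-- The links of an odd subdivision of `K₄`. -/
structure Tetra (G : SimpleGraph V) (a b c d : V) (ab ac ad bc bd cd : Multiset V) : Prop where
  ab : OddLink G a ab b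
  ac : OddLink G a ac c
  ad : OddLink G a ad d
  bc : OddLink G b bc c
  bd : OddLink G b bd d
  cd : OddLink G c cd d

section Tetra

variable {a b c d u s : V} {ab ac ad bc bd cd R A B A' B' : Multiset V}

theorem Tetra.swap (h : Tetra G a b c d ab ac ad bc bd cd) :
    Tetra G a b d c ab ad ac bd bc cd :=
  ⟨h.ab, h.ad, h.ac, h.bd, h.bc, h.cd.symm⟩

theorem Tetra.rotate (h : Tetra G a b c d ab ac ad bc bd cd) :
    Tetra G b c a d bc ab bd ac cd ad :=
  ⟨h.bc, h.ab.symm, h.bd, h.ac.symm, h.cd, h.ad⟩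

theorem Tetra.triangle (h : Tetra G a b c d ab ac ad bc bd cd) :
    OddLink G b (bc + {c} + cd + {d} + bd) b :=
  h.bc.trans₃ h.cd h.bd.symm

/-- Both ends of the ear are at even distance from a, so the ear closes an odd cycle through a; the
link ad joins it to the triangle on b, c, d. -/
theorem Tetra.extendsBy_center_center (h : Tetra G a b c d ab ac ad bc bd cd)
    (hR : OddLink G u R s) (hA : EvenLink G u A a) (hB : OddLink G u B b)
    (hA' : EvenLink G s A' a) (hB' : OddLink G s B' c) :
    ExtendsBy G ({a} + {b} + {c} + {d} + (A + B) + (A' + B') + ad + bc + bd + cd) R :=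
  extendsBy_of_barbell (S' := {a} + {d} + (A' + A) + ad + (bd + {b} + bc + {c} + cd))
    (D := B + B') (hA'.oddLink (hA.oddLink hR).symm) h.ad (h.bd.symm.trans₃ h.bc h.cd)
    (hB.matched.add hB'.matched) (by abel) (by abel)

/-- The node a moves to u: the ear followed by A' replaces the link to c, and the old a becomes
interior to the link from u to d. -/
theorem Tetra.extendsBy_center_outer (h : Tetra G a b c d ab ac ad bc bd cd)
    (hR : OddLink G u R s) (hA : EvenLink G u A a) (hB : OddLink G u B b)
    (hA' : EvenLink G s A' c) (hB' : OddLink G s B' a) :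
    ExtendsBy G ({a} + {b} + {c} + {d} + (A + B) + (A' + B') + ad + bc + bd + cd) R := by
  obtain ⟨T, hT, e⟩ := hA.symm
  rw [show {a} + {b} + {c} + {d} + (A + B) + (A' + B') + ad + bc + bd + cd =
    {b} + {c} + {d} + (A + {a} + B) + (A' + B') + ad + bc + bd + cd by abel, e]
  exact extendsBy_of_tetrahedron (S' := {u} + {b} + {c} + {d} + B + A' + (T + ad) + bc + bd + cd)
    (D := B') hB (hA'.oddLink hR.symm).symm (hT.oddLink h.ad) h.bc h.bd h.cd hB'.matched
    (by abel) (by abel)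

/-- The ear replaces the link ac: the nodes a and c move to u and s and become interior to the links
towards d. -/
theorem Tetra.extendsBy_outer_outer (h : Tetra G a b c d ab ac ad bc bd cd)
    (hR : OddLink G u R s) (hA : EvenLink G u A a) (hB : OddLink G u B b)
    (hA' : EvenLink G s A' c) (hB' : OddLink G s B' b) :
    ExtendsBy G ({a} + {b} + {c} + {d} + (A + B) + ac + ad + (A' + B') + bd + cd) R := by
  obtain ⟨T, hT, e⟩ := hA.symm
  obtain ⟨T', hT', e'⟩ := hA'.symm
  rw [show {a} + {b} + {c} + {d} + (A + B) + ac + ad + (A' + B') + bd + cd =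
    {b} + {d} + (A + {a} + B) + ac + ad + (A' + {c} + B') + bd + cd by abel, e, e']
  exact extendsBy_of_tetrahedron
    (S' := {b} + {u} + {s} + {d} + B + B' + bd + (T + ad) + (T' + cd))
    (D := ac) hB.symm hB'.symm h.bd hR (hT.oddLink h.ad) (hT'.oddLink h.cd) h.ac.matched
    (by abel) (by abel)

/-- Again the ear replaces ac, now with a interior to the link from u to d and c interior to the
link from s to b. -/
theorem Tetra.extendsBy_opposite (h : Tetra G a b c d ab ac ad bc bd cd)
    (hR : OddLink G u R s) (hA : EvenLink G u A a) (hB : OddLink G u B b)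
    (hA' : EvenLink G s A' c) (hB' : OddLink G s B' d) :
    ExtendsBy G ({a} + {b} + {c} + {d} + (A + B) + ac + ad + bc + bd + (A' + B')) R := by
  obtain ⟨T, hT, e⟩ := hA.symm
  obtain ⟨T', hT', e'⟩ := hA'.symm
  rw [show {a} + {b} + {c} + {d} + (A + B) + ac + ad + bc + bd + (A' + B') =
    {b} + {d} + (A + {a} + B) + ac + ad + bc + bd + (A' + {c} + B') by abel, e, e']
  exact extendsBy_of_tetrahedron
    (S' := {u} + {b} + {s} + {d} + B + (T + ad) + (T' + bc) + bd + B')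
    (D := ac) hB hR (hT.oddLink h.ad) (hT'.oddLink h.bc.symm).symm h.bd hB' h.ac.matched
    (by abel) (by abel)

/-- The ear and the even piece C form an odd cycle, which B joins to the triangle on b, c, d. -/
theorem Tetra.extendsBy_of_pendant (h : Tetra G a b c d ab ac ad bc bd cd) {x y : V}
    {C : Multiset V} (hA : EvenLink G a A x) (hC : EvenLink G x C y) (hB : OddLink G y B b)
    (hR : OddLink G x R y) (e : {a} + ab = A + C + {y} + B) :
    ExtendsBy G ({a} + {b} + {c} + {d} + ab + ac + ad + bc + bd + cd) R := by
  rw [show {a} + {b} + {c} + {d} + ab + ac + ad + bc + bd + cd =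
    {b} + {c} + {d} + ({a} + ab) + ac + ad + bc + bd + cd by abel, e]
  exact extendsBy_of_barbell (S' := {y} + {b} + C + B + (bc + {c} + cd + {d} + bd))
    (D := A + ac + ad) (hC.oddLink hR) hB h.triangle
    ((hA.matched.add h.ac.matched).add h.ad.matched) (by abel) (by abel)

theorem Tetra.extendsBy_same (h : Tetra G a b c d ab ac ad bc bd cd)
    (hR : OddLink G u R s) (hu : u ∈ {a} + ab + {b}) (hs : s ∈ {a} + ab + {b}) :
    ExtendsBy G ({a} + {b} + {c} + {d} + ab + ac + ad + bc + bd + cd) R := by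
  rcases h.ab.split₂ hu hs hR with ⟨L', D, h1, h2, rfl⟩ | ⟨x, y, A, C, B, h1, h2, h3, h4, e⟩ |
    ⟨x, y, A, C, B, h1, h2, h3, h4, e⟩
  · exact extendsBy_of_tetrahedron (S' := {a} + {b} + {c} + {d} + L' + ac + ad + bc + bd + cd)
      (D := D) h1 h.ac h.ad h.bc h.bd h.cd h2 (by abel) (by abel)
  · exact h.extendsBy_of_pendant h1 h2 h3 h4 e
  · have h' : Tetra G b a c d ab bc bd ac ad cd := ⟨h.ab.symm, h.bc, h.bd, h.ac, h.ad, h.cd⟩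
    have := h'.extendsBy_of_pendant h1 h2 h3 h4 e
    rwa [show {b} + {a} + {c} + {d} + ab + bc + bd + ac + ad + cd =
      {a} + {b} + {c} + {d} + ab + ac + ad + bc + bd + cd by abel] at this

/-- Up to exchanging c and d (`Tetra.swap`), these are all positions of s off the link ab. -/
theorem Tetra.extendsBy_half (h : Tetra G a b c d ab ac ad bc bd cd)
    (hR : OddLink G u R s) (hA : EvenLink G u A a) (hB : OddLink G u B b) (e : ab = A + B)
    (hs : s ∈ {a} + ac + {c} ∨ s ∈ {b} + bc + {c} ∨
      ∃ A' B', EvenLink G s A' c ∧ OddLink G s B' d ∧ cd = A' + B') :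
    ExtendsBy G ({a} + {b} + {c} + {d} + ab + ac + ad + bc + bd + cd) R := by
  subst e
  rcases hs with hs | hs | ⟨A', B', hA', hB', rfl⟩
  · rcases h.ac.split' hs with ⟨A', B', hA', hB', rfl⟩ | ⟨A', B', hA', hB', rfl⟩
    · exact h.extendsBy_center_center hR hA hB hA' hB'
    · exact h.extendsBy_center_outer hR hA hB hA' hB'
  · rcases h.bc.split' hs with ⟨A', B', hA', hB', rfl⟩ | ⟨A', B', hA', hB', rfl⟩
    · have := h.rotate.extendsBy_center_outer hR.symm hA' hB' hA hB
      rwa [show {b} + {c} + {a} + {d} + (A' + B') + (A + B) + bd + ac + cd + ad =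
        {a} + {b} + {c} + {d} + (A + B) + ac + ad + (A' + B') + bd + cd by abel] at this
    · exact h.extendsBy_outer_outer hR hA hB hA' hB'
  · exact h.extendsBy_opposite hR hA hB hA' hB'

theorem Tetra.extendsBy_of_normal (h : Tetra G a b c d ab ac ad bc bd cd)
    (hR : OddLink G u R s) (hA : EvenLink G u A a) (hB : OddLink G u B b) (e : ab = A + B)
    (hu : u ∈ {a} + ab + {b})
    (hs : s ∈ {a} + {b} + {c} + {d} + ab + ac + ad + bc + bd + cd) :
    ExtendsBy G ({a} + {b} + {c} + {d} + ab + ac + ad + bc + bd + cd) R := by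
  have key : s ∈ {a} + ab + {b} ∨ s ∈ {a} + ac + {c} ∨ s ∈ {b} + bc + {c} ∨
      s ∈ {a} + ad + {d} ∨ s ∈ {b} + bd + {d} ∨ s ∈ {c} + cd + {d} := by
    simp only [Multiset.mem_add, Multiset.mem_singleton] at hs ⊢; tauto
  have hswap : (s ∈ {a} + ad + {d} ∨ s ∈ {b} + bd + {d} ∨
      ∃ A' B', EvenLink G s A' d ∧ OddLink G s B' c ∧ cd = A' + B') →
      ExtendsBy G ({a} + {b} + {c} + {d} + ab + ac + ad + bc + bd + cd) R := fun hs' ↦ by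
    have := h.swap.extendsBy_half hR hA hB e hs'
    rwa [show {a} + {b} + {d} + {c} + ab + ad + ac + bd + bc + cd =
      {a} + {b} + {c} + {d} + ab + ac + ad + bc + bd + cd by abel] at this
  rcases key with hs | hs | hs | hs | hs | hs
  · exact h.extendsBy_same hR hu hs
  · exact h.extendsBy_half hR hA hB e (.inl hs)
  · exact h.extendsBy_half hR hA hB e (.inr (.inl hs))
  · exact hswap (.inl hs)
  · exact hswap (.inr (.inl hs))
  · rcases h.cd.split' hs with h' | h'
    · exact h.extendsBy_half hR hA hB e (.inr (.inr h'))
    · exact hswap (.inr (.inr h'))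

/-- Relabelling the nodes so that a given vertex lies on the first link, at even distance from the
first node. -/
theorem Tetra.exists_normal (h : Tetra G a b c d ab ac ad bc bd cd)
    (hu : u ∈ {a} + {b} + {c} + {d} + ab + ac + ad + bc + bd + cd) :
    ∃ (a' b' c' d' : V) (A B ac' ad' bc' bd' cd' : Multiset V),
      Tetra G a' b' c' d' (A + B) ac' ad' bc' bd' cd' ∧ EvenLink G u A a' ∧ OddLink G u B b' ∧
      {a} + {b} + {c} + {d} + ab + ac + ad + bc + bd + cd =
        {a'} + {b'} + {c'} + {d'} + (A + B) + ac' + ad' + bc' + bd' + cd' ∧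
      u ∈ {a'} + (A + B) + {b'} := by
  have main : ∀ {a b c d : V} {ab ac ad bc bd cd : Multiset V},
      Tetra G a b c d ab ac ad bc bd cd → u ∈ {a} + ab + {b} →
      ∃ (a' b' c' d' : V) (A B ac' ad' bc' bd' cd' : Multiset V),
      Tetra G a' b' c' d' (A + B) ac' ad' bc' bd' cd' ∧ EvenLink G u A a' ∧ OddLink G u B b' ∧
      {a} + {b} + {c} + {d} + ab + ac + ad + bc + bd + cd =
        {a'} + {b'} + {c'} + {d'} + (A + B) + ac' + ad' + bc' + bd' + cd' ∧
      u ∈ {a'} + (A + B) + {b'} := by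
    intro a b c d ab ac ad bc bd cd h hu
    rcases h.ab.split' hu with ⟨A, B, hA, hB, rfl⟩ | ⟨A, B, hA, hB, rfl⟩
    · exact ⟨a, b, c, d, A, B, ac, ad, bc, bd, cd, h, hA, hB, rfl, hu⟩
    · refine ⟨b, a, c, d, A, B, bc, bd, ac, ad, cd,
        ⟨h.ab.symm, h.bc, h.bd, h.ac, h.ad, h.cd⟩, hA, hB, by abel, ?_⟩
      rwa [show {b} + (A + B) + {a} = {a} + (A + B) + {b} by abel]
  have key : u ∈ {a} + ab + {b} ∨ u ∈ {a} + ac + {c} ∨ u ∈ {b} + bc + {c} ∨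
      u ∈ {a} + ad + {d} ∨ u ∈ {b} + bd + {d} ∨ u ∈ {c} + cd + {d} := by
    simp only [Multiset.mem_add, Multiset.mem_singleton] at hu ⊢; tauto
  rcases key with hu | hu | hu | hu | hu | hu
  · exact main h hu
  · rw [show {a} + {b} + {c} + {d} + ab + ac + ad + bc + bd + cd =
      {a} + {c} + {b} + {d} + ac + ab + ad + bc + cd + bd by abel]
    exact main ⟨h.ac, h.ab, h.ad, h.bc.symm, h.cd, h.bd⟩ hu
  · rw [show {a} + {b} + {c} + {d} + ab + ac + ad + bc + bd + cd =
      {b} + {c} + {a} + {d} + bc + ab + bd + ac + cd + ad by abel]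
    exact main h.rotate hu
  · rw [show {a} + {b} + {c} + {d} + ab + ac + ad + bc + bd + cd =
      {a} + {d} + {b} + {c} + ad + ab + ac + bd + cd + bc by abel]
    exact main ⟨h.ad, h.ab, h.ac, h.bd.symm, h.cd.symm, h.bc⟩ hu
  · rw [show {a} + {b} + {c} + {d} + ab + ac + ad + bc + bd + cd =
      {b} + {d} + {a} + {c} + bd + ab + bc + ad + cd + ac by abel]
    exact main ⟨h.bd, h.ab.symm, h.bc, h.ad.symm, h.cd.symm, h.ac⟩ hu
  · rw [show {a} + {b} + {c} + {d} + ab + ac + ad + bc + bd + cd =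
      {c} + {d} + {a} + {b} + cd + ac + bc + ad + bd + ab by abel]
    exact main ⟨h.cd, h.ac.symm, h.bc.symm, h.ad.symm, h.bd.symm, h.ab⟩ hu

end Tetra

/-! ### Ears on two joined odd cycles. -/

section Barbell

variable {a b u s : V} {A L B R : Multiset V}

theorem extendsBy_barbell_path (hA : OddLink G a A a) (hL : OddLink G a L b)
    (hB : OddLink G b B b) (hR : OddLink G u R s) (hu : u ∈ {a} + L + {b})
    (hs : s ∈ {a} + L + {b}) : ExtendsBy G ({a} + {b} + A + L + B) R := by
  rcases hL.split₂ hu hs hR with ⟨L', D, h1, h2, rfl⟩ | ⟨x, y, P, C, Q, h1, h2, h3, h4, e⟩ |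
    ⟨x, y, P, C, Q, h1, h2, h3, h4, e⟩
  · exact extendsBy_of_barbell (S' := {a} + {b} + A + L' + B) (D := D) hA h1 hB h2
      (by abel) (by abel)
  · rw [show {a} + {b} + A + L + B = {b} + A + ({a} + L) + B by abel, e]
    exact extendsBy_of_barbell (S' := {y} + {b} + C + Q + B) (D := A + P) (h2.oddLink h4) h3 hB
      (hA.matched.add h1.matched) (by abel) (by abel)
  · rw [show {a} + {b} + A + L + B = {a} + A + ({b} + L) + B by abel, e]
    exact extendsBy_of_barbell (S' := {y} + {a} + C + Q + A) (D := B + P) (h2.oddLink h4) h3 hA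
      (hB.matched.add h1.matched) (by abel) (by abel)

/-- If the ear cannot replace an odd piece of the cycle, it closes an odd cycle with an even piece.
That cycle becomes the new loop, attached through the even piece P followed by L. -/
theorem extendsBy_barbell_loop (hA : OddLink G a A a) (hL : OddLink G a L b)
    (hB : OddLink G b B b) (hR : OddLink G u R s) (hu : u ∈ {a} + A) (hs : s ∈ {a} + A) :
    ExtendsBy G ({a} + {b} + A + L + B) R := by
  have main : (∃ x y P C Q, EvenLink G a P x ∧ EvenLink G x C y ∧ OddLink G y Q a ∧
      OddLink G x R y ∧ {a} + A = P + C + {y} + Q) → ExtendsBy G ({a} + {b} + A + L + B) R := by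
    rintro ⟨x, y, P, C, Q, h1, h2, h3, h4, e⟩
    obtain ⟨T, hT, e'⟩ := h2.symm
    rw [show {a} + {b} + A + L + B = {b} + ({a} + A) + L + B by abel, e, add_assoc P, e']
    exact extendsBy_of_barbell (S' := {x} + {b} + T + (P + L) + B) (D := Q)
      (hT.oddLink h4.symm) (h1.oddLink hL) hB h3.matched (by abel) (by abel)
  rcases hA.split₂ (Multiset.mem_add.2 (.inl hu)) (Multiset.mem_add.2 (.inl hs)) hR with
    ⟨L', D, h1, h2, rfl⟩ | h1 | h1
  · exact extendsBy_of_barbell (S' := {a} + {b} + L' + L + B) (D := D) h1 hL hB h2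
      (by abel) (by abel)
  · exact main h1
  · exact main h1

theorem OddLink.split_loop (hA : OddLink G a A a) (hs : s ∈ {a} + A) :
    ∃ P Q, EvenLink G s P a ∧ OddLink G s Q a ∧ A = P + Q := by
  rcases hA.split' (Multiset.mem_add.2 (.inl hs)) with h | h <;> exact h

/-- An odd cycle can be traversed from any of its vertices. -/
theorem OddLink.rebase (hA : OddLink G a A a) (hs : s ∈ {a} + A) :
    ∃ A', OddLink G s A' s ∧ {a} + A = {s} + A' := by
  obtain ⟨P, Q, hP, hQ, rfl⟩ := hA.split_loop hs
  obtain ⟨T, hT, e⟩ := hP.symm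
  exact ⟨T + Q, hT.oddLink hQ.symm, by
    rw [show {a} + (P + Q) = P + {a} + Q by abel, e]; abel⟩

/-- If u is at even distance from a, the ear closes a new odd cycle through a, based at u. Otherwise
it replaces the part of L towards a, the old cycle being rebased at s. -/
theorem extendsBy_barbell_path_loop (hA : OddLink G a A a) (hL : OddLink G a L b)
    (hB : OddLink G b B b) (hR : OddLink G u R s) (hu : u ∈ {a} + L + {b}) (hs : s ∈ {a} + A) :
    ExtendsBy G ({a} + {b} + A + L + B) R := by
  rcases hL.split' hu with ⟨P, Q, hP, hQ, rfl⟩ | ⟨P, Q, hP, hQ, rfl⟩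
  · obtain ⟨P', Q', hP', hQ', rfl⟩ := hA.split_loop hs
    obtain ⟨T, hT, e⟩ := hP.symm
    rw [show {a} + {b} + (P' + Q') + (P + Q) + B = {b} + (P' + Q') + (P + {a} + Q) + B by abel, e]
    exact extendsBy_of_barbell (S' := {u} + {b} + (P' + T) + Q + B) (D := Q')
      ((hT.oddLink (hP'.oddLink hR.symm))) hQ hB hQ'.matched
      (by abel) (by abel)
  · obtain ⟨A', hA', e⟩ := hA.rebase hs
    rw [show {a} + {b} + A + (P + Q) + B = ({a} + A) + {b} + (P + Q) + B by abel, e]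
    exact extendsBy_of_barbell (S' := {s} + {b} + A' + P + B) (D := Q) hA'
      (hP.oddLink hR).symm hB hQ.matched (by abel) (by abel)

theorem extendsBy_barbell_loop_loop (hA : OddLink G a A a) (hL : OddLink G a L b)
    (hB : OddLink G b B b) (hR : OddLink G u R s) (hu : u ∈ {a} + A) (hs : s ∈ {b} + B) :
    ExtendsBy G ({a} + {b} + A + L + B) R := by
  obtain ⟨A', hA', e⟩ := hA.rebase hu
  obtain ⟨B', hB', e'⟩ := hB.rebase hs
  rw [show {a} + {b} + A + L + B = ({a} + A) + L + ({b} + B) by abel, e, e']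
  exact extendsBy_of_barbell (S' := {u} + {s} + A' + B') (D := L) hA' hR hB' hL.matched
    (by abel) (by abel)

theorem extendsBy_barbell (hA : OddLink G a A a) (hL : OddLink G a L b)
    (hB : OddLink G b B b) (hR : OddLink G u R s) (hu : u ∈ {a} + {b} + A + L + B)
    (hs : s ∈ {a} + {b} + A + L + B) : ExtendsBy G ({a} + {b} + A + L + B) R := by
  have e : {a} + {b} + A + L + B = {b} + {a} + B + L + A := by abel
  have key : ∀ {x : V}, x ∈ {a} + {b} + A + L + B →
      x ∈ {a} + A ∨ x ∈ {a} + L + {b} ∨ x ∈ {b} + B := by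
    intro x hx
    simp only [Multiset.mem_add, Multiset.mem_singleton] at hx ⊢; tauto
  have el : {a} + L + {b} = {b} + L + {a} := by abel
  rcases key hu with hu | hu | hu <;> rcases key hs with hs | hs | hs
  · exact extendsBy_barbell_loop hA hL hB hR hu hs
  · exact extendsBy_barbell_path_loop hA hL hB hR.symm hs hu
  · exact extendsBy_barbell_loop_loop hA hL hB hR hu hs
  · exact extendsBy_barbell_path_loop hA hL hB hR hu hs
  · exact extendsBy_barbell_path hA hL hB hR hu hs
  · rw [e]; exact extendsBy_barbell_path_loop hB hL.symm hA hR (el ▸ hu) hs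
  · exact extendsBy_barbell_loop_loop hA hL hB hR.symm hs hu
  · rw [e]; exact extendsBy_barbell_path_loop hB hL.symm hA hR.symm (el ▸ hs) hu
  · rw [e]; exact extendsBy_barbell_loop hB hL.symm hA hR hu hs

end Barbell

theorem IsPosyShape.extendsBy {S R : Multiset V} (hS : IsPosyShape G S) {u s : V} (hu : u ∈ S)
    (hs : s ∈ S) (hR : OddLink G u R s) : ExtendsBy G S R := by
  cases hS with
  | barbell hA hL hB => exact extendsBy_barbell hA hL hB hR hu hs
  | tetrahedron h1 h2 h3 h4 h5 h6 =>
    obtain ⟨a', b', c', d', A, B, ac', ad', bc', bd', cd', h, hA, hB, e, hu'⟩ :=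
      Tetra.exists_normal ⟨h1, h2, h3, h4, h5, h6⟩ hu
    rw [e] at hs ⊢
    exact h.extendsBy_of_normal hR hA hB rfl hu' hs

/-- From each vertex of a posy shape an odd link inside the shape leads to an odd cycle. -/
theorem IsPosyShape.exists_link {S : Multiset V} (hS : IsPosyShape G S) {u : V} (hu : u ∈ S) :
    ∃ b Q C D, OddLink G u Q b ∧ OddLink G b C b ∧ Matched G D ∧ S = {u} + Q + {b} + C + D := by
  cases hS with
  | @barbell a b A L B hA hL hB =>
    have key : u ∈ {a} + A ∨ u ∈ {a} + L + {b} ∨ u ∈ {b} + B := by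
      simp only [Multiset.mem_add, Multiset.mem_singleton] at hu ⊢; tauto
    have main : ∀ {a b : V} {A B : Multiset V}, OddLink G a A a → OddLink G a L b →
        OddLink G b B b → u ∈ {a} + A → ∃ b' Q C D, OddLink G u Q b' ∧ OddLink G b' C b' ∧
          Matched G D ∧ {a} + {b} + A + L + B = {u} + Q + {b'} + C + D := by
      intro a b A B hA hL hB hu
      obtain ⟨P, Q, hP, hQ, rfl⟩ := hA.split_loop hu
      obtain ⟨T, hT, e⟩ := hP.symm
      refine ⟨b, T + L, B, Q, hT.oddLink hL, hB, hQ.matched, ?_⟩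
      rw [show {a} + {b} + (P + Q) + L + B = {b} + (P + {a} + Q) + L + B by abel, e]; abel
    rcases key with hu | hu | hu
    · exact main hA hL hB hu
    · rcases hL.split hu with ⟨P, Q, hP, hQ, e⟩ | ⟨P, Q, hP, hQ, e⟩
      · refine ⟨b, Q, B, P + A, hQ, hB, hP.matched.add hA.matched, ?_⟩
        rw [show {a} + {b} + A + L + B = {b} + A + ({a} + L) + B by abel, e]; abel
      · refine ⟨a, Q, A, P + B, hQ, hA, hP.matched.add hB.matched, ?_⟩
        rw [show {a} + {b} + A + L + B = {a} + A + ({b} + L) + B by abel, e]; abel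
    · rw [show {a} + {b} + A + L + B = {b} + {a} + B + L + A by abel]
      exact main hB hL.symm hA hu
  | tetrahedron h1 h2 h3 h4 h5 h6 =>
    obtain ⟨a, b, c, d, A, B, ac, ad, bc, bd, cd, h, hA, hB, e, -⟩ :=
      Tetra.exists_normal ⟨h1, h2, h3, h4, h5, h6⟩ hu
    obtain ⟨T, hT, e'⟩ := hA.symm
    refine ⟨b, B, _, T + ac + ad, hB, h.triangle,
      (hT.matched.add h.ac.matched).add h.ad.matched, ?_⟩
    rw [e, show {a} + {b} + {c} + {d} + (A + B) + ac + ad + bc + bd + cd =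
      {b} + {c} + {d} + (A + {a} + B) + ac + ad + bc + bd + cd by abel, e']
    abel

theorem IsPosyShape.extendsBy_lollipop {S T C : Multiset V} (hS : IsPosyShape G S) {u z : V}
    (hu : u ∈ S) (hT : EvenLink G z T u) (hC : OddLink G z C z) : ExtendsBy G S (T + C) := by
  obtain ⟨b, Q, B, D, h1, h2, h3, rfl⟩ := hS.exists_link hu
  obtain ⟨T', hT', e⟩ := hT.symm
  refine extendsBy_of_barbell (S' := {u} + Q + {b} + B) (D := D) hC (hT'.oddLink h1) h2 h3 rfl ?_
  rw [show {u} + Q + {b} + B + (T + C) = T + {u} + Q + {b} + B + C by abel, e]; abel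

/-! ### Posy shapes spread along edges. -/

/-- `v` lies in a posy shape whose complement has a perfect matching. -/
def InPosyShape [Fintype V] (G : SimpleGraph V) (v : V) : Prop :=
  ∃ S, IsPosyShape G S ∧ Nice G S ∧ v ∈ S

theorem ExtendsBy.inPosyShape [Fintype V] {S R : Multiset V} (h : ExtendsBy G S R)
    (hN : Nice G (S + R)) {v : V} (hv : v ∈ R) : InPosyShape G v := by
  obtain ⟨S', D, hS', hD, rfl⟩ := h
  exact ⟨S' + R, hS', Nice.of_add (by rwa [add_right_comm] at hN) hD, by simp [hv]⟩

theorem IsBicritical.inPosyShape_of_adj [Fintype V] (hG : IsBicritical G) {u v : V}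
    (hu : InPosyShape G u) (huv : G.Adj u v) : InPosyShape G v := by
  obtain ⟨S, hS, ⟨R, hR, e⟩, huS⟩ := hu
  by_cases hvS : v ∈ S
  · exact ⟨S, hS, ⟨R, hR, e⟩, hvS⟩
  have hvR : v ∈ R := by
    have : v ∈ S + R := e ▸ Finset.mem_univ v
    exact (Multiset.mem_add.1 this).resolve_left hvS
  obtain ⟨v', T, hvv', hT, rfl⟩ := hR.exists_partner hvR
  -- The search starts at the partner v' of v, so an odd link from v' back to S extends through v to
  -- an odd ear at u, and a stem ending at v' extends to an even link ending at u.
  have hN : Nice G ({v'} + {v} + S) := ⟨T, hT, by rw [← e]; abel⟩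
  obtain ⟨w, hw, h⟩ := hG.explore hN (by simp) (by simp)
  rw [Multiset.mem_singleton] at hw
  subst hw
  rcases h with ⟨z, T, C, h1, h2, h3⟩ | ⟨x, hx, hxw, Q, h1, h2⟩
  · have h4 := h1.trans (EvenLink.cons hvv'.symm huv.symm (.refl u))
    refine (hS.extendsBy_lollipop huS h4 h2).inPosyShape ?_ (v := v) (by simp)
    rwa [show S + (T + ({w} + {v} + 0) + C) = {w} + {v} + S + (T + C) by abel]
  · have hxS : x ∈ S := by
      simp only [Multiset.mem_add, Multiset.mem_singleton] at hx; tauto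
    refine (hS.extendsBy huS hxS (.cons huv hvv' h1)).inPosyShape ?_ (v := v) (by simp)
    rwa [show S + ({v} + {w} + Q) = {w} + {v} + S + Q by abel]

theorem IsBicritical.inPosyShape_of_reachable [Fintype V] (hG : IsBicritical G) {u v : V}
    (h : G.Reachable u v) (hu : InPosyShape G u) : InPosyShape G v := by
  obtain ⟨p⟩ := h
  induction p with
  | nil => exact hu
  | cons h _ ih => exact ih (hG.inPosyShape_of_adj hu h)

/-! ### Even cycles with an odd chord, and the first posy shape. -/

/-- `ColoredLink G a W B b`: a walk of positive even length from `a` to `b` whose internal vertices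
are alternately in `W` and in `B`, beginning and ending in `W`. -/
inductive ColoredLink (G : SimpleGraph V) : V → Multiset V → Multiset V → V → Prop
  | single {a x b : V} : G.Adj a x → G.Adj x b → ColoredLink G a {x} 0 b
  | cons {a x y b : V} {W B : Multiset V} : G.Adj a x → G.Adj x y → ColoredLink G y W B b →
      ColoredLink G a ({x} + W) ({y} + B) b

namespace ColoredLink

variable {a b : V} {W B : Multiset V}

theorem snoc {x y : V} (h : ColoredLink G a W B b) (hx : G.Adj b x) (hy : G.Adj x y) :
    ColoredLink G a (W + {x}) (B + {b}) y := by
  induction h with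
  | single h1 h2 => simpa [add_comm] using ColoredLink.cons h1 h2 (.single hx hy)
  | cons h1 h2 _ ih => simpa only [add_assoc] using ColoredLink.cons h1 h2 (ih hx)

theorem symm (h : ColoredLink G a W B b) : ColoredLink G b W B a := by
  induction h with
  | single h1 h2 => exact .single h2.symm h1.symm
  | @cons a x y b W B h1 h2 _ ih =>
    rw [add_comm _ W, add_comm _ B]
    exact ih.snoc h2.symm h1.symm

theorem card_eq (h : ColoredLink G a W B b) : W.card = B.card + 1 := by
  induction h with
  | single => simp
  | cons _ _ _ ih => simp [ih]

theorem evenLink (h : ColoredLink G a W B b) : EvenLink G a ({a} + (W + B)) b := by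
  induction h with
  | single h1 h2 => simpa using EvenLink.cons h1 h2 (.refl _)
  | @cons a x y b W B h1 h2 _ ih =>
    have := EvenLink.cons h1 h2 ih
    rwa [show {a} + {x} + ({y} + (W + B)) = {a} + ({x} + W + ({y} + B)) by abel] at this

theorem oddLink_of_adj {x : V} (h : ColoredLink G a W B b) (hx : G.Adj x a) :
    OddLink G x ({a} + (W + B)) b := by
  simpa using (h.evenLink.oddLink (.edge hx.symm)).symm

theorem split (h : ColoredLink G a W B b) {w : V} (hw : w ∈ W) :
    ∃ P Q, OddLink G a P w ∧ OddLink G w Q b ∧ W + B = P + {w} + Q := by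
  induction h with
  | single h1 h2 =>
    rw [Multiset.mem_singleton] at hw
    subst hw
    exact ⟨0, 0, .edge h1, .edge h2, by simp⟩
  | @cons a x y b W B h1 h2 h3 ih =>
    by_cases hwx : w = x
    · subst hwx
      exact ⟨0, _, .edge h1, h3.oddLink_of_adj h2, by abel⟩
    · obtain ⟨P, Q, h4, h5, e⟩ := ih (by simpa [hwx] using hw)
      refine ⟨_, Q, .cons h1 h2 h4, h5, ?_⟩
      rw [show {x} + W + ({y} + B) = {x} + {y} + (W + B) by abel, e]; abel

theorem split₂ (h : ColoredLink G a W B b) {w w' : V} (hw : w ∈ W) (hw' : w' ∈ W) (hne : w ≠ w') :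
    ∃ p q P C Q, OddLink G a P p ∧ EvenLink G p C q ∧ OddLink G q Q b ∧
      W + B = P + C + {q} + Q ∧ (p = w ∧ q = w' ∨ p = w' ∧ q = w) := by
  induction h with
  | single h1 h2 =>
    rw [Multiset.mem_singleton] at hw hw'
    exact absurd (hw.trans hw'.symm) hne
  | @cons a x y b W B h1 h2 h3 ih =>
    have main : ∀ {q : V}, q ∈ W → ∃ P C Q, OddLink G a P x ∧ EvenLink G x C q ∧
        OddLink G q Q b ∧ {x} + W + ({y} + B) = P + C + {q} + Q := by
      intro q hq
      obtain ⟨P, Q, h4, h5, e⟩ := h3.split hq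
      refine ⟨0, _, Q, .edge h1, (OddLink.edge h2).evenLink h4, h5, ?_⟩
      rw [show {x} + W + ({y} + B) = {x} + {y} + (W + B) by abel, e]; abel
    by_cases hwx : w = x
    · subst hwx
      obtain ⟨P, C, Q, h⟩ := main (q := w') (by simpa [hne.symm] using hw')
      exact ⟨w, w', P, C, Q, h.1, h.2.1, h.2.2.1, h.2.2.2, .inl ⟨rfl, rfl⟩⟩
    by_cases hwx' : w' = x
    · subst hwx'
      obtain ⟨P, C, Q, h⟩ := main (q := w) (by simpa [hne] using hw)
      exact ⟨w', w, P, C, Q, h.1, h.2.1, h.2.2.1, h.2.2.2, .inr ⟨rfl, rfl⟩⟩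
    · obtain ⟨p, q, P, C, Q, h4, h5, h6, e, h7⟩ :=
        ih (by simpa [hwx] using hw) (by simpa [hwx'] using hw')
      refine ⟨p, q, _, C, Q, .cons h1 h2 h4, h5, h6, ?_, h7⟩
      rw [show {x} + W + ({y} + B) = {x} + {y} + (W + B) by abel, e]; abel

end ColoredLink

theorem EvenLink.eq_or_mem {a b : V} {S : Multiset V} (h : EvenLink G a S b) :
    a = b ∧ S = 0 ∨ a ∈ S := by
  cases h with
  | refl => exact .inl ⟨rfl, rfl⟩
  | cons => simp

theorem EvenLink.exists_coloredLink {a b : V} {S : Multiset V} (h : EvenLink G a S b)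
    (hab : a ≠ b) (hb : b ∉ S) : ∃ W B, ColoredLink G a W B b ∧ S = {a} + (W + B) := by
  induction h with
  | refl => exact absurd rfl hab
  | @cons a x y b S h1 h2 h3 ih =>
    have hbS : b ∉ S := fun h ↦ hb (by simp [h])
    by_cases hyb : y = b
    · subst hyb
      rcases h3.eq_or_mem with ⟨-, rfl⟩ | h4
      · exact ⟨_, _, .single h1 h2, by abel⟩
      · exact absurd h4 hbS
    · obtain ⟨W, B, h4, rfl⟩ := ih hyb hbS
      exact ⟨_, _, .cons h1 h2 h4, by abel⟩

/-- An even cycle through `b` and `s` that are joined by an odd chord with interior `C`, both arcs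
between `b` and `s` being of even length. -/
structure Theta (G : SimpleGraph V) (b s : V) (W₁ B₁ W₂ B₂ C : Multiset V) : Prop where
  arc₁ : ColoredLink G b W₁ B₁ s
  arc₂ : ColoredLink G b W₂ B₂ s
  chord : OddLink G b C s

section Theta

variable {b s : V} {W₁ B₁ W₂ B₂ C : Multiset V}

theorem Theta.swap (h : Theta G b s W₁ B₁ W₂ B₂ C) : Theta G b s W₂ B₂ W₁ B₁ C :=
  ⟨h.arc₂, h.arc₁, h.chord⟩

theorem Theta.symm (h : Theta G b s W₁ B₁ W₂ B₂ C) : Theta G s b W₁ B₁ W₂ B₂ C :=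
  ⟨h.arc₁.symm, h.arc₂.symm, h.chord.symm⟩

theorem Theta.odd_cycle (h : Theta G b s W₁ B₁ W₂ B₂ C) :
    OddLink G s ({b} + (W₂ + B₂) + C) s :=
  h.arc₂.evenLink.oddLink h.chord

variable [Fintype V]

/-- The second arc and the chord form an odd cycle at s; the part Q of the first arc, prolonged by
the stem, joins it to the new odd cycle. -/
theorem Theta.inPosyShape_of_lollipop (h : Theta G b s W₁ B₁ W₂ B₂ C) {w z : V}
    (hw : w ∈ W₁) {T D : Multiset V} (hT : EvenLink G z T w) (hD : OddLink G z D z)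
    (hN : Nice G ({b} + {s} + (W₁ + B₁) + (W₂ + B₂) + C + (T + D))) : InPosyShape G b := by
  obtain ⟨P, Q, hP, hQ, e⟩ := h.arc₁.split hw
  obtain ⟨T', hT', e'⟩ := hT.symm
  refine ⟨_, .barbell hD (hT'.oddLink hQ) h.odd_cycle, Nice.of_add (D := P) ?_ hP.matched,
    by simp⟩
  rw [e, show {b} + {s} + (P + {w} + Q) + (W₂ + B₂) + C + (T + D) =
    {b} + {s} + (P + Q) + (W₂ + B₂) + C + (T + {w} + D) by abel, e'] at hN
  convert hN using 1
  abel

/-- Two vertices of the same colour are at even distance on the arc, so the ear closes an odd cycle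
there; Q joins it to the cycle of the second arc and the chord. -/
theorem Theta.inPosyShape_of_ear_same (h : Theta G b s W₁ B₁ W₂ B₂ C) {w x : V} (hwx : w ≠ x)
    (hw : w ∈ W₁) (hx : x ∈ W₁) {R : Multiset V} (hR : OddLink G w R x)
    (hN : Nice G ({b} + {s} + (W₁ + B₁) + (W₂ + B₂) + C + R)) : InPosyShape G b := by
  obtain ⟨p, q, P, D, Q, h1, h2, h3, e, h4⟩ := h.arc₁.split₂ hw hx hwx
  have hR' : OddLink G p R q := by
    rcases h4 with ⟨rfl, rfl⟩ | ⟨rfl, rfl⟩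
    · exact hR
    · exact hR.symm
  refine ⟨_, .barbell (h2.oddLink hR') h3 h.odd_cycle, Nice.of_add (D := P) ?_ h1.matched,
    by simp⟩
  rw [e] at hN
  convert hN using 1
  abel

/-- A K₄ subdivision on b, s, w, x, in which the chord and the ear are opposite links. -/
theorem Theta.inPosyShape_of_ear_opposite (h : Theta G b s W₁ B₁ W₂ B₂ C) {w x : V}
    (hw : w ∈ W₁) (hx : x ∈ W₂) {R : Multiset V} (hR : OddLink G w R x)
    (hN : Nice G ({b} + {s} + (W₁ + B₁) + (W₂ + B₂) + C + R)) : InPosyShape G b := by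
  obtain ⟨P, Q, hP, hQ, e⟩ := h.arc₁.split hw
  obtain ⟨P', Q', hP', hQ', e'⟩ := h.arc₂.split hx
  refine ⟨_, .tetrahedron h.chord hP hP' hQ.symm hQ'.symm hR, ?_, by simp⟩
  rw [e, e'] at hN
  convert hN using 1
  abel

/-- The new endpoints are b and x. One arc runs through w and the ear, the other along the second
arc to s and then along the chord to x; the rest of the chord is the new chord. -/
theorem Theta.exists_smaller_aux (h : Theta G b s W₁ B₁ W₂ B₂ C) {w x : V}
    (hw : w ∈ W₁) (hxC : x ∈ C) {R Ts C' : Multiset V} (hR : OddLink G w R x)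
    (hN : Nice G ({b} + {s} + (W₁ + B₁) + (W₂ + B₂) + C + R))
    (hTs : EvenLink G s Ts x) (hC' : OddLink G x C' b) (e : {s} + C = Ts + {x} + C') :
    ∃ W₁' B₁' W₂' B₂' C', Theta G b x W₁' B₁' W₂' B₂' C' ∧
      Nice G ({b} + {x} + (W₁' + B₁') + (W₂' + B₂') + C') ∧ C'.card < C.card := by
  obtain ⟨P, Q, hP, hQ, e1⟩ := h.arc₁.split hw
  have hN' : Nice G ({b} + (P + {w} + Q) + (W₂ + B₂) + (Ts + {x} + C') + R) := by
    rw [e1, show {b} + {s} + (P + {w} + Q) + (W₂ + B₂) + C + R =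
      {b} + (P + {w} + Q) + (W₂ + B₂) + ({s} + C) + R by abel, e] at hN
    exact hN
  have hnd := hN'.nodup
  have hdup : ∀ {T U : Multiset V}, (T + U).Nodup → ∀ {y}, y ∈ T → y ∉ U := fun h _ ↦
    Multiset.disjoint_left.1 (Multiset.nodup_add.1 h).2.2
  have hx : x ∉ {b} + P + {w} + Q + (W₂ + B₂) + Ts + C' + R := by
    rw [show {b} + (P + {w} + Q) + (W₂ + B₂) + (Ts + {x} + C') + R =
      {x} + ({b} + P + {w} + Q + (W₂ + B₂) + Ts + C' + R) by abel] at hnd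
    exact hdup hnd (by simp)
  simp only [Multiset.mem_add, Multiset.mem_singleton, not_or] at hx
  -- An empty Ts would force x = s, but s is not interior to the chord; hence the new chord is
  -- strictly shorter.
  have hTs0 : Ts ≠ 0 := by
    rintro rfl
    rcases hTs.eq_or_mem with ⟨rfl, -⟩ | h
    · rw [zero_add] at e
      have hs := hN.nodup
      rw [show {b} + {s} + (W₁ + B₁) + (W₂ + B₂) + C + R =
        {s} + ({b} + (W₁ + B₁) + (W₂ + B₂) + C + R) by abel] at hs
      exact hdup hs (y := s) (by simp) (by simp [hxC])
    · simp at h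
  obtain ⟨W, B, h1, e2⟩ := (hP.evenLink hR).exists_coloredLink (by tauto)
    (by simp only [Multiset.mem_add, Multiset.mem_singleton]; tauto)
  obtain ⟨W', B', h2, e3⟩ := (h.arc₂.evenLink.trans hTs).exists_coloredLink (by tauto)
    (by simp only [Multiset.mem_add, Multiset.mem_singleton]; tauto)
  refine ⟨W, B, W', B', C', ⟨h1, h2, hC'.symm⟩, Nice.of_add (D := Q) ?_ hQ.matched, ?_⟩
  · rw [add_assoc, add_assoc] at e2
    rw [add_assoc] at e3
    rw [← add_left_cancel e2, ← add_left_cancel e3]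
    convert hN' using 1
    abel
  · have := congrArg Multiset.card e
    have h4 := Multiset.card_pos.2 hTs0
    simp only [Multiset.card_add, Multiset.card_singleton] at this
    omega

theorem Theta.exists_smaller (h : Theta G b s W₁ B₁ W₂ B₂ C) {w x : V}
    (hw : w ∈ W₁) (hxC : x ∈ C) {R : Multiset V} (hR : OddLink G w R x)
    (hN : Nice G ({b} + {s} + (W₁ + B₁) + (W₂ + B₂) + C + R)) :
    ∃ b' s' W₁' B₁' W₂' B₂' C', Theta G b' s' W₁' B₁' W₂' B₂' C' ∧ G.Reachable b b' ∧
      Nice G ({b'} + {s'} + (W₁' + B₁') + (W₂' + B₂') + C') ∧ C'.card < C.card := by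
  rcases h.chord.split (x := x) (by simp [hxC]) with ⟨T, C', h1, h2, e⟩ | ⟨T, C', h1, h2, e⟩
  · obtain ⟨W, B, W', B', D, h3, h4, h5⟩ := h.symm.exists_smaller_aux hw hxC hR
      (by rwa [add_comm ({b} : Multiset V)] at hN) h1 h2 e
    exact ⟨s, x, W, B, W', B', D, h3, h.chord.reachable, h4, h5⟩
  · obtain ⟨W, B, W', B', D, h3, h4, h5⟩ := h.exists_smaller_aux hw hxC hR hN h1 h2 e
    exact ⟨b, x, W, B, W', B', D, h3, .rfl, h4, h5⟩

theorem Theta.step (h : Theta G b s W₁ B₁ W₂ B₂ C) {w : V} (hw : w ∈ W₁)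
    (hN : (∃ z T D, EvenLink G z T w ∧ OddLink G z D z ∧
        Nice G ({b} + {s} + (W₁ + B₁) + (W₂ + B₂) + C + (T + D))) ∨
      ∃ x ∈ W₁ + W₂ + C, x ≠ w ∧ ∃ R, OddLink G w R x ∧
        Nice G ({b} + {s} + (W₁ + B₁) + (W₂ + B₂) + C + R)) :
    InPosyShape G b ∨
      ∃ b' s' W₁' B₁' W₂' B₂' C', Theta G b' s' W₁' B₁' W₂' B₂' C' ∧ G.Reachable b b' ∧
        Nice G ({b'} + {s'} + (W₁' + B₁') + (W₂' + B₂') + C') ∧ C'.card < C.card := by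
  rcases hN with ⟨z, T, D, hT, hD, hN⟩ | ⟨x, hx, hxw, R, hR, hN⟩
  · exact .inl (h.inPosyShape_of_lollipop hw hT hD hN)
  · simp only [Multiset.mem_add] at hx
    rcases hx with (hx | hx) | hx
    · exact .inl (h.inPosyShape_of_ear_same hxw.symm hw hx hR hN)
    · exact .inl (h.inPosyShape_of_ear_opposite hw hx hR hN)
    · exact .inr (h.exists_smaller hw hx hR hN)

theorem Theta.exists_inPosyShape (hG : IsBicritical G) (h : Theta G b s W₁ B₁ W₂ B₂ C)
    (hN : Nice G ({b} + {s} + (W₁ + B₁) + (W₂ + B₂) + C)) :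
    ∃ x, G.Reachable b x ∧ InPosyShape G x := by
  induction hn : C.card using Nat.strong_induction_on generalizing b s W₁ B₁ W₂ B₂ C with
  | _ n ih =>
    have hc₁ := h.arc₁.card_eq
    have hc₂ := h.arc₂.card_eq
    have e : (W₁ + W₂) + ({b} + {s} + B₁ + B₂) + C =
      {b} + {s} + (W₁ + B₁) + (W₂ + B₂) + C := by abel
    have e' : {b} + {s} + (W₁ + B₁) + (W₂ + B₂) + C = {b} + {s} + (W₂ + B₂) + (W₁ + B₁) + C := by
      abel
    -- Each arc has one more vertex in W than in B, so W₁ + W₂ has exactly as many elements as b, s,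
    -- B₁ and B₂ together.
    obtain ⟨w, hw, hs⟩ := hG.explore (Wh := W₁ + W₂) (Bl := {b} + {s} + B₁ + B₂) (Y := C)
      (by rwa [e]) (by simp [hc₁, hc₂]; omega)
      (by intro h0; have := congrArg Multiset.card h0; simp [hc₁] at this)
    rw [e] at hs
    have key : InPosyShape G b ∨
        ∃ b' s' W₁' B₁' W₂' B₂' C', Theta G b' s' W₁' B₁' W₂' B₂' C' ∧ G.Reachable b b' ∧
          Nice G ({b'} + {s'} + (W₁' + B₁') + (W₂' + B₂') + C') ∧ C'.card < C.card := by
      rcases Multiset.mem_add.1 hw with hw | hw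
      · exact h.step hw hs
      · rw [e', add_comm W₁ W₂] at hs
        exact h.swap.step hw hs
    rcases key with h1 | ⟨b', s', W₁', B₁', W₂', B₂', C', h1, h2, h3, h4⟩
    · exact ⟨b, .rfl, h1⟩
    · obtain ⟨x, h5, h6⟩ := ih _ (hn ▸ h4) h1 h3 rfl
      exact ⟨x, h2.trans h5, h6⟩

end Theta

theorem IsBicritical.exists_inPosyShape [Fintype V] (hG : IsBicritical G)
    (hM : Matched G Finset.univ.val) (y : V) : ∃ x, G.Reachable y x ∧ InPosyShape G x := by
  obtain ⟨y', T, hyy', hT, e⟩ := hM.exists_partner (Finset.mem_univ_val y)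
  obtain ⟨w, hw, h⟩ := hG.explore (Wh := {y}) (Bl := {y'}) (Y := 0)
    ⟨T, hT, by rw [e, add_zero]⟩ (by simp) (by simp)
  rw [Multiset.mem_singleton] at hw
  subst hw
  rcases h with ⟨z, T, C, hT, hC, hN⟩ | ⟨x, hx, hxw, -⟩
  swap
  · simp [hxw] at hx
  obtain ⟨T', hT', eT⟩ := hT.symm
  -- The first vertex after z on the odd walk from z along the stem to y'; the rest of that walk is
  -- matched and is dropped.
  obtain ⟨z', D, hzz', hD, eD⟩ := (hT'.oddLink (.edge hyy')).exists_first
  have hN' : Nice G ({z'} + {z} + C) := by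
    refine Nice.of_add (D := D) ?_ hD
    rw [show {w} + {y'} + 0 + (T + C) = T + {w} + {y'} + C by abel, eT] at hN
    rw [show {z'} + {z} + C + D = {z'} + D + {z} + C by abel, ← eD]
    convert hN using 1
    abel
  have hwz : G.Reachable w z := hT'.reachable
  obtain ⟨w', hw', h⟩ := hG.explore hN' (by simp) (by simp)
  rw [Multiset.mem_singleton] at hw'
  subst hw'
  rcases h with ⟨p, P, A, hP, hA, hN⟩ | ⟨x, hx, hxw, R, hR, hN⟩
  · obtain ⟨P', hP', eP⟩ := hP.symm
    refine ⟨z, hwz, _, .barbell hA (hP'.oddLink (.edge hzz'.symm)) hC, ?_, by simp⟩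
    rw [show {w'} + {z} + C + (P + A) = P + {w'} + {z} + C + A by abel, eP] at hN
    convert hN using 1
    abel
  · have hxC : x ∈ C := by
      simp only [Multiset.mem_add, Multiset.mem_singleton] at hx; tauto
    -- One of the two arcs of the cycle C between z and x is even. Together with the even link
    -- through z' and R it gives the even cycle of a theta; the odd arc is the chord.
    have hsplit : ∃ A B, EvenLink G z A x ∧ OddLink G x B z ∧ {z} + C = A + {x} + B := by
      rcases hC.split (x := x) (by simp [hxC]) with h | h <;> exact h
    obtain ⟨A, B, hA, hB, e⟩ := hsplit
    have hN'' : Nice G ({w'} + (A + {x} + B) + R) := by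
      rwa [add_assoc ({w'} : Multiset V), e] at hN
    have hnd := hN''.nodup
    rw [show {w'} + (A + {x} + B) + R = {x} + ({w'} + A + B + R) by abel] at hnd
    have hx := Multiset.disjoint_left.1 (Multiset.nodup_add.1 hnd).2.2 (Multiset.mem_singleton_self x)
    have hzx : z ≠ x := by
      rintro rfl
      have := hN'.nodup
      rw [show {w'} + {z} + C = {z} + ({w'} + C) by abel] at this
      exact Multiset.disjoint_left.1 (Multiset.nodup_add.1 this).2.2
        (Multiset.mem_singleton_self z) (by simp [hxC])
    simp only [Multiset.mem_add, Multiset.mem_singleton, not_or] at hx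
    obtain ⟨W₁, B₁, h1, rfl⟩ := hA.exists_coloredLink hzx (by tauto)
    obtain ⟨W₂, B₂, h2, e2⟩ := ((OddLink.edge hzz').evenLink hR).exists_coloredLink hzx
      (by simp only [Multiset.mem_add, Multiset.mem_singleton, add_zero]; tauto)
    rw [add_zero, add_assoc] at e2
    have e2' := add_left_cancel e2
    obtain ⟨x', h3, h4⟩ := Theta.exists_inPosyShape hG ⟨h1, h2, hB.symm⟩ (by
      rw [← e2']
      convert hN'' using 1
      abel)
    exact ⟨x', hwz.trans h3, h4⟩

theorem IsBicritical.inPosyShape [Fintype V] (hG : IsBicritical G)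
    (hM : Matched G Finset.univ.val) (v : V) : InPosyShape G v := by
  obtain ⟨x, h1, h2⟩ := hG.exists_inPosyShape hM v
  exact hG.inPosyShape_of_reachable h1.symm h2

/-! ### Realising posy shapes as posies of a suitable perfect matching. -/

/-- A path with internal vertices `l`, consecutive pairs of which are matched by `m`. -/
inductive InnerMatched (G : SimpleGraph V) (m : V → V) : V → List V → V → Prop
  | edge {a b : V} : G.Adj a b → InnerMatched G m a [] b
  | cons {a x y b : V} {l : List V} : G.Adj a x → G.Adj x y → m x = y →
      InnerMatched G m y l b → InnerMatched G m a (x :: y :: l) b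

/-- A path with vertices `l`, consecutive pairs of which are matched by `m`. -/
inductive FullyMatched (G : SimpleGraph V) (m : V → V) : V → List V → V → Prop
  | edge {a b : V} : G.Adj a b → m a = b → FullyMatched G m a [a, b] b
  | cons {a x y b : V} {l : List V} : G.Adj a x → m a = x → G.Adj x y →
      FullyMatched G m y l b → FullyMatched G m a (a :: x :: l) b

section Links

variable {m : V → V} {a b c d : V} {l l₁ l₂ l₃ : List V}

theorem InnerMatched.trans (h : InnerMatched G m a l₁ c) (h' : FullyMatched G m c l₂ d)
    (h'' : InnerMatched G m d l₃ b) : InnerMatched G m a (l₁ ++ l₂ ++ l₃) b := by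
  induction h with
  | @edge a c h =>
    induction h' generalizing a with
    | edge h1 h2 => exact .cons h h1 h2 h''
    | cons h1 h2 h3 _ ih => exact .cons h h1 h2 (ih h'' h3)
  | cons h1 h2 h3 _ ih => exact .cons h1 h2 h3 (ih h')

theorem InnerMatched.snoc {x y : V} (h : InnerMatched G m a l b) (hx : G.Adj b x) (hm : m b = x)
    (hy : G.Adj x y) : InnerMatched G m a (l ++ [b, x]) y := by
  simpa using h.trans (.edge hx hm) (.edge hy)

theorem InnerMatched.symm (h : InnerMatched G m a l b) (hm : ∀ x ∈ l, m (m x) = x) :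
    InnerMatched G m b l.reverse a := by
  induction h with
  | edge h => exact .edge h.symm
  | @cons a x y b l h1 h2 h3 _ ih =>
    have h4 : m y = x := by rw [← h3]; exact hm x (by simp)
    simpa using (ih fun x hx ↦ hm x (by simp [hx])).snoc h2.symm h4 h1.symm

/-- `Φ` holds for each map that agrees on `S` with a certain perfect matching of `S`. -/
def Forces (G : SimpleGraph V) (S : Multiset V) (Φ : (V → V) → Prop) : Prop :=
  ∃ m, IsPartner G m S ∧ ∀ m', (∀ x ∈ S, m' x = m x) → Φ m'

theorem Forces.mono {S : Multiset V} {Φ Ψ : (V → V) → Prop} (h : Forces G S Φ)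
    (h' : ∀ m, Φ m → Ψ m) : Forces G S Ψ := by
  obtain ⟨m, h1, h2⟩ := h
  exact ⟨m, h1, fun m' hm ↦ h' _ (h2 m' hm)⟩

theorem Forces.add {S T : Multiset V} {Φ Ψ : (V → V) → Prop} (hS : Forces G S Φ)
    (hT : Forces G T Ψ) (hd : (S + T).Nodup) : Forces G (S + T) fun m ↦ Φ m ∧ Ψ m := by
  classical
  obtain ⟨m₁, h1, h2⟩ := hS
  obtain ⟨m₂, h3, h4⟩ := hT
  have hd' : ∀ x, x ∈ S → x ∉ T := fun _ ↦
    Multiset.disjoint_left.1 (Multiset.nodup_add.1 hd).2.2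
  have e1 : ∀ x ∈ S, (if x ∈ S then m₁ x else m₂ x) = m₁ x := fun x hx ↦ by simp [hx]
  have e2 : ∀ x ∈ T, (if x ∈ S then m₁ x else m₂ x) = m₂ x := fun x hx ↦ by
    have : x ∉ S := fun h ↦ hd' x h hx
    simp [this]
  refine ⟨fun x ↦ if x ∈ S then m₁ x else m₂ x, fun x hx ↦ ?_, fun m' hm ↦ ⟨h2 _ ?_, h4 _ ?_⟩⟩
  · rcases Multiset.mem_add.1 hx with hx | hx
    · obtain ⟨h5, h6, h7⟩ := h1 x hx
      simp only [e1 x hx, e1 _ h5]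
      exact ⟨by simp [h5], h6, h7⟩
    · obtain ⟨h5, h6, h7⟩ := h3 x hx
      simp only [e2 x hx, e2 _ h5]
      exact ⟨by simp [h5], h6, h7⟩
  · exact fun x hx ↦ (hm x (by simp [hx])).trans (e1 x hx)
  · exact fun x hx ↦ (hm x (by simp [hx])).trans (e2 x hx)

theorem Forces.pair {x y : V} (h : G.Adj x y) : Forces G ({x} + {y}) fun m ↦ m x = y := by
  classical
  refine ⟨fun z ↦ if z = x then y else x, fun z hz ↦ ?_, fun m hm ↦ ?_⟩
  · simp only [Multiset.mem_add, Multiset.mem_singleton] at hz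
    rcases hz with rfl | rfl
    · simp [h, h.ne']
    · simp [h.symm, h.ne']
  · simpa using hm x (by simp)

theorem Matched.forces {S : Multiset V} (h : Matched G S) (hS : S.Nodup) :
    Forces G S fun _ ↦ True := by
  obtain ⟨m, hm⟩ := h.exists_isPartner hS
  exact ⟨m, hm, fun _ _ ↦ trivial⟩

theorem OddLink.forces_innerMatched {S : Multiset V} (h : OddLink G a S b) (hS : S.Nodup) :
    Forces G S fun m ↦ ∃ l : List V, (l : Multiset V) = S ∧ InnerMatched G m a l b := by
  induction h with
  | edge h => exact ⟨id, by simp [IsPartner], fun m _ ↦ ⟨[], rfl, .edge h⟩⟩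
  | @cons a x y b S h1 h2 _ ih =>
    refine ((Forces.pair h2).add (ih (Multiset.nodup_add.1 hS).2.1) hS).mono ?_
    rintro m ⟨h3, l, rfl, h4⟩
    refine ⟨x :: y :: l, ?_, .cons h1 h2 h3 h4⟩
    rw [← Multiset.cons_coe, ← Multiset.cons_coe, ← Multiset.singleton_add,
      ← Multiset.singleton_add, add_assoc]

theorem OddLink.forces_fullyMatched {S : Multiset V} (h : OddLink G a S b)
    (hS : ({a} + S + {b}).Nodup) :
    Forces G ({a} + S + {b}) fun m ↦
      ∃ l : List V, (l : Multiset V) = {a} + S + {b} ∧ FullyMatched G m a l b := by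
  induction h with
  | @edge a b h =>
    rw [add_zero] at hS ⊢
    exact (Forces.pair h).mono fun m hm ↦ ⟨[a, b], rfl, .edge h hm⟩
  | @cons a x y b S h1 h2 _ ih =>
    rw [show {a} + ({x} + {y} + S) + {b} = {a} + {x} + ({y} + S + {b}) by abel] at hS ⊢
    refine ((Forces.pair h1).add (ih (Multiset.nodup_add.1 hS).2.1) hS).mono ?_
    rintro m ⟨h3, l, h5, h4⟩
    refine ⟨a :: x :: l, ?_, .cons h1 h3 h2 h4⟩
    rw [← h5, ← Multiset.cons_coe, ← Multiset.cons_coe, ← Multiset.singleton_add,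
      ← Multiset.singleton_add, add_assoc]

end Links

section Walks

variable {m : V → V} {a b : V} {l : List V}

/-- The perfect matching given by an involution that moves each vertex to a neighbour. -/
def partnerSubgraph (G : SimpleGraph V) (m : V → V) (hm : ∀ x, G.Adj x (m x) ∧ m (m x) = x) :
    G.Subgraph where
  verts := Set.univ
  Adj x y := m x = y
  adj_sub := by rintro x _ rfl; exact (hm x).1
  edge_vert _ := trivial
  symm := ⟨by rintro x _ rfl; exact (hm x).2⟩

variable (hm : ∀ x, G.Adj x (m x) ∧ m (m x) = x)

theorem partnerSubgraph_isPerfectMatching : (partnerSubgraph G m hm).IsPerfectMatching :=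
  Subgraph.isPerfectMatching_iff.2 fun v ↦ ⟨m v, rfl, fun _ h ↦ Eq.symm h⟩

theorem mk_mem_partnerSubgraph {x y : V} : s(x, y) ∈ (partnerSubgraph G m hm).edgeSet ↔ m x = y :=
  Iff.rfl

theorem FullyMatched.exists_walk (h : FullyMatched G m a l b) (hl : l.Nodup) :
    ∃ p : G.Walk a b, p.support = l ∧ IsMMPath (partnerSubgraph G m hm) p := by
  suffices H : ∃ p : G.Walk a b, p.support = l ∧
      IsAlternatingWalk (partnerSubgraph G m hm) p ∧ p.edges.head? = some s(a, m a) ∧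
      ∃ e ∈ p.edges.getLast?, e ∈ (partnerSubgraph G m hm).edgeSet by
    obtain ⟨p, h1, h2, h3, h4⟩ := H
    exact ⟨p, h1, .mk' (h1 ▸ hl), h2, ⟨_, h3, rfl⟩, h4⟩
  induction h with
  | edge h h' =>
    subst h'
    exact ⟨h.toWalk, by simp, by simp [IsAlternatingWalk], by simp, _, by simp; rfl, rfl⟩
  | @cons a x y b l h1 h2 h3 h4 ih =>
    subst h2
    obtain ⟨p, h5, h6, h7, e, h8, h9⟩ := ih (by simp at hl; exact hl.2.2)
    have hne : m (m a) ≠ y := by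
      rw [(hm a).2]
      rintro rfl
      have : a ∈ l := by rw [← h5]; exact p.start_mem_support
      simp [this] at hl
    refine ⟨.cons h1 (.cons h3 p), by simp [h5], ?_, by simp, e, ?_, h9⟩
    · simp only [IsAlternatingWalk, Walk.edges_cons, List.isChain_cons_cons] at h6 ⊢
      refine ⟨.inl ⟨rfl, hne⟩, List.isChain_cons.2 ⟨?_, h6⟩⟩
      rw [h7]
      rintro _ ⟨⟩
      exact .inr ⟨rfl, hne⟩
    · simp only [Walk.edges_cons, List.getLast?_cons_cons]
      rw [List.getLast?_cons]
      simp only [Option.mem_def] at h8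
      simp [h8]

/-- The hypothesis `ha` keeps the edges that enter pairs, in particular the one leaving a, out of
the matching, so exactly the listed pairs are counted. -/
theorem InnerMatched.exists_walk (h : InnerMatched G m a l b) (hl : (l ++ [b]).Nodup)
    (ha : m a ∉ l ++ [b]) :
    ∃ p : G.Walk a b, p.support = a :: (l ++ [b]) ∧ ∃ k, l.length = 2 * k ∧
      {e | e ∈ p.edges ∧ e ∈ (partnerSubgraph G m hm).edgeSet}.ncard = k := by
  induction h with
  | @edge a b h =>
    refine ⟨h.toWalk, by simp, 0, rfl, ?_⟩
    convert Set.ncard_empty (Sym2 V)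
    rw [Set.eq_empty_iff_forall_notMem]
    rintro e ⟨h1, h2⟩
    obtain rfl : e = s(a, b) := by simpa using h1
    exact ha (by simpa using mk_mem_partnerSubgraph hm |>.1 h2)
  | @cons a x y b l h1 h2 h3 _ ih =>
    subst h3
    simp only [List.cons_append, List.nodup_cons, List.mem_cons, not_or] at hl ha
    obtain ⟨p, h4, k, h5, h6⟩ := ih hl.2.2 (by rw [(hm x).2]; exact hl.1.2)
    refine ⟨.cons h1 (.cons h2 p), by simp [h4], k + 1, by simp [h5]; ring, ?_⟩
    have hx : s(x, m x) ∉ p.edges := by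
      intro h
      have := p.fst_mem_support_of_mem_edges h
      rw [h4, List.mem_cons] at this
      tauto
    rw [← h6, ← Set.ncard_insert_of_notMem (a := s(x, m x)) (fun h ↦ hx h.1)
      ((List.finite_toSet p.edges).subset fun e he ↦ he.1)]
    congr 1
    ext e
    simp only [Walk.edges_cons, List.mem_cons, Set.mem_ofPred_eq, Set.mem_insert_iff]
    constructor
    · rintro ⟨rfl | rfl | h, h'⟩
      · exact absurd (mk_mem_partnerSubgraph hm |>.1 h') ha.1
      · exact .inl rfl
      · exact .inr ⟨h, h'⟩
    · rintro (rfl | ⟨h, h'⟩)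
      · exact ⟨.inr (.inl rfl), rfl⟩
      · exact ⟨.inr (.inr h), h'⟩

theorem InnerMatched.exists_blossom (h : InnerMatched G m b l b) (hl : (l ++ [b]).Nodup)
    (hb : m b ∉ l) :
    ∃ c : G.Walk b b, c.support = b :: (l ++ [b]) ∧ IsBlossom (partnerSubgraph G m hm) c := by
  have hbb : m b ≠ b := (hm b).1.ne'
  obtain ⟨c, h1, k, h2, h3⟩ := h.exists_walk hm hl (by simp [hb, hbb])
  have hlen : c.length = 2 * k + 1 := by
    have := c.length_support
    rw [h1] at this
    simp at this
    omega
  have hl0 : l ≠ [] := by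
    rintro rfl
    cases h with
    | edge h => exact h.ne rfl
  have hk : k ≠ 0 := by
    rintro rfl
    exact hl0 (List.length_eq_zero_iff.1 h2)
  refine ⟨c, h1, ?_, ⟨k, hlen, h3⟩, ?_⟩
  · rw [Walk.isCycle_iff_isPath_tail_and_le_length]
    refine ⟨.mk' ?_, by omega⟩
    have : ¬ c.Nil := by rw [← Walk.length_eq_zero_iff]; omega
    rw [Walk.support_tail_of_not_nil _ this, h1]
    exact hl
  · intro e he hbe heM
    obtain ⟨z, rfl⟩ := hbe
    have h4 := c.snd_mem_support_of_mem_edges he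
    have h5 : m b = z := mk_mem_partnerSubgraph hm |>.1 heM
    rw [h1, ← h5] at h4
    simp [hb, hbb] at h4

end Walks

/-! ### Maximum and perfect matchings. -/

theorem _root_.SimpleGraph.Subgraph.IsMatching.two_mul_ncard_edgeSet [Finite V] {M : G.Subgraph}
    (hM : M.IsMatching) : 2 * M.edgeSet.ncard = M.verts.ncard := by
  classical
  have := Fintype.ofFinite V
  have hv : M.verts.toFinset = M.edgeSet.toFinset.biUnion Sym2.toFinset := by
    ext v
    simp only [Set.mem_toFinset, Finset.mem_biUnion, Sym2.mem_toFinset]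
    rw [hM.verts_eq_biUnion_edgeSet]
    simp
  rw [Set.ncard_eq_toFinset_card', Set.ncard_eq_toFinset_card', hv, Finset.card_biUnion]
  · rw [Finset.sum_const_nat (m := 2), mul_comm]
    intro e he
    apply Sym2.card_toFinset_of_not_isDiag
    exact G.not_isDiag_of_mem_edgeSet (M.edgeSet_subset (by simpa using he))
  · intro e he e' he' hne
    rw [Function.onFun, Finset.disjoint_left]
    intro v hv hv'
    rw [Sym2.mem_toFinset] at hv hv'
    obtain ⟨x, rfl⟩ := hv
    obtain ⟨y, rfl⟩ := hv'
    simp only [Set.coe_toFinset, Subgraph.mem_edgeSet] at he he'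
    exact hne (by rw [hM.eq_of_adj_left he he'])

theorem isMaximumMatching_of_isPerfectMatching [Finite V] {M : G.Subgraph}
    (hM : M.IsPerfectMatching) : IsMaximumMatching M := by
  refine ⟨hM.1, fun N hN ↦ ?_⟩
  have h1 := hM.1.two_mul_ncard_edgeSet
  have h2 := hN.two_mul_ncard_edgeSet
  have h3 : N.verts.ncard ≤ M.verts.ncard :=
    Set.ncard_le_ncard (fun v _ ↦ hM.2 v) (Set.toFinite _)
  omega

theorem IsMaximumMatching.isPerfectMatching [Finite V] {M : G.Subgraph} (hM : IsMaximumMatching M)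
    (hG : ∃ N : G.Subgraph, N.IsPerfectMatching) : M.IsPerfectMatching := by
  obtain ⟨N, hN⟩ := hG
  refine ⟨hM.1, fun v ↦ ?_⟩
  have h1 := hM.1.two_mul_ncard_edgeSet
  have h2 := hN.1.two_mul_ncard_edgeSet
  have h3 := hM.2 N hN.1
  have h4 : N.verts = Set.univ := Set.eq_univ_of_forall hN.2
  have h5 : M.verts = Set.univ := by
    apply Set.eq_of_subset_of_ncard_le (Set.subset_univ _) _ (Set.toFinite _)
    rw [← h4]
    omega
  rw [h5]
  trivial

theorem FullyMatched.mem_ends {m : V → V} {a b : V} {l : List V} (h : FullyMatched G m a l b) :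
    a ∈ l ∧ b ∈ l := by
  induction h with
  | edge => simp
  | cons _ _ _ _ ih => simp [ih.2]

theorem FullyMatched.partner_mem {m : V → V} (hm : ∀ x, m (m x) = x) {a b : V} {l : List V}
    (h : FullyMatched G m a l b) {x : V} (hx : x ∈ l) : m x ∈ l := by
  induction h with
  | @edge a b h h' =>
    subst h'
    simp only [List.mem_cons, List.not_mem_nil, or_false] at hx ⊢
    rcases hx with rfl | rfl
    · simp
    · exact .inl (hm a)
  | cons h1 h2 h3 _ ih =>
    subst h2
    simp only [List.mem_cons] at hx ⊢
    rcases hx with rfl | rfl | hx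
    · simp
    · exact .inl (hm _)
    · exact .inr (.inr (ih hx))

theorem _root_.List.IsInfix.of_append_left {α : Type*} {A B : List α} {x y : α}
    (h : [x, y] <:+: A ++ B) (hx : x ∉ A) : [x, y] <:+: B := by
  induction A with
  | nil => exact h
  | cons a A ih =>
    rw [List.cons_append, List.infix_cons_iff] at h
    rcases h with h | h
    · rw [List.cons_prefix_cons] at h
      exact absurd (by simp [h.1]) hx
    · exact ih h fun h' ↦ hx (by simp [h'])

theorem _root_.List.IsInfix.of_append_right {α : Type*} {A B : List α} {x y : α}
    (h : [x, y] <:+: A ++ B) (hy : y ∉ B) : [x, y] <:+: A := by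
  have h' : [y, x] <:+: B.reverse ++ A.reverse := by
    have := List.reverse_infix.2 h
    simpa using this
  have := List.reverse_infix.2 (h'.of_append_left (by simpa using hy))
  simpa using this

/-- An edge of a walk is a pair of consecutive entries of its support. The ends of a common edge
avoid A and B, so they are consecutive inside T. -/
theorem inf_toSubgraph_eq {a a' b b' c c' : V} {p : G.Walk a a'} {p' : G.Walk b b'}
    {q : G.Walk c c'} {A B A' B' T : List V} (hp : p.support = A ++ T ++ B)
    (hp' : p'.support = A' ++ T ++ B') (hq : q.support = T)
    (h : ∀ x, x ∈ A ∨ x ∈ B → x ∉ A' ++ T ++ B') (h' : ∀ x, x ∈ A' ∨ x ∈ B' → x ∉ A ++ T ++ B) :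
    p.toSubgraph ⊓ p'.toSubgraph = q.toSubgraph := by
  ext x y
  · simp only [Subgraph.verts_inf, Set.mem_inter_iff, Walk.mem_verts_toSubgraph, hp, hp', hq]
    have := h x
    have := h' x
    simp only [List.mem_append] at *
    tauto
  · simp only [Subgraph.inf_adj, Walk.adj_toSubgraph_iff_mem_edges]
    constructor
    · rintro ⟨h1, h2⟩
      have hx := p'.fst_mem_support_of_mem_edges h2
      have hy := p'.snd_mem_support_of_mem_edges h2
      rw [hp'] at hx hy
      have hx' : x ∉ A ∧ x ∉ B := ⟨fun h3 ↦ h x (.inl h3) hx, fun h3 ↦ h x (.inr h3) hx⟩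
      have hy' : y ∉ A ∧ y ∉ B := ⟨fun h3 ↦ h y (.inl h3) hy, fun h3 ↦ h y (.inr h3) hy⟩
      rw [← Walk.infix_support_iff_mem_edges, hp] at h1
      rw [← Walk.infix_support_iff_mem_edges, hq]
      refine h1.imp (fun h1 ↦ ?_) fun h1 ↦ ?_
      · exact (h1.of_append_right hy'.2).of_append_left hx'.1
      · exact (h1.of_append_right hx'.2).of_append_left hy'.1
    · intro h1
      rw [← Walk.infix_support_iff_mem_edges, hq] at h1
      rw [← Walk.infix_support_iff_mem_edges, ← Walk.infix_support_iff_mem_edges, hp, hp']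
      exact ⟨h1.imp (fun h ↦ h.trans (List.infix_append _ _ _))
          fun h ↦ h.trans (List.infix_append _ _ _),
        h1.imp (fun h ↦ h.trans (List.infix_append _ _ _))
          fun h ↦ h.trans (List.infix_append _ _ _)⟩

theorem inf_toSubgraph_eq_bot {a a' b b' : V} {p : G.Walk a a'} {p' : G.Walk b b'}
    (h : ∀ x ∈ p.support, x ∉ p'.support) : p.toSubgraph ⊓ p'.toSubgraph = ⊥ := by
  ext x y
  · simpa using h x
  · simp only [Subgraph.inf_adj, Subgraph.not_bot_adj, iff_false, not_and]
    intro h1 h2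
    exact h x (p.mem_verts_toSubgraph.1 h1.fst_mem) (p'.mem_verts_toSubgraph.1 h2.fst_mem)

section Posy

variable [Fintype V]

theorem Forces.exists_partner {S : Multiset V} {Φ : (V → V) → Prop} (h : Forces G S Φ)
    (hS : S = Finset.univ.val) : ∃ m, (∀ x, G.Adj x (m x) ∧ m (m x) = x) ∧ Φ m := by
  obtain ⟨m, h1, h2⟩ := h
  exact ⟨m, fun x ↦ (h1 x (hS ▸ Finset.mem_univ x)).2, h2 m fun _ _ ↦ rfl⟩

/-- The connecting path is matched including its ends and each cycle only in its interior, so a and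
b are the bases of two disjoint blossoms. -/
theorem mem_SD_of_barbell {a b : V} {A L B : Multiset V} (hA : OddLink G a A a)
    (hL : OddLink G a L b) (hB : OddLink G b B b) (hN : Nice G ({a} + {b} + A + L + B)) {v : V}
    (hv : v ∈ {a} + {b} + A + L + B) : v ∈ SD G := by
  obtain ⟨R, hR, e⟩ := hN
  have e' : ({a} + L + {b}) + A + B + R = Finset.univ.val := by rw [← e]; abel
  have hnd : (({a} + L + {b}) + A + B + R).Nodup := e' ▸ Finset.univ.nodup
  have hnd₁ := (Multiset.nodup_add.1 hnd).1
  have hnd₂ := (Multiset.nodup_add.1 hnd₁).1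
  have hnd₃ := Multiset.nodup_add.1 hnd₂
  obtain ⟨m, hm, ⟨⟨⟨lp, hp, hlp⟩, ⟨la, hla, h1⟩⟩, ⟨lb, hlb, h2⟩⟩, -⟩ :=
    ((((hL.forces_fullyMatched hnd₃.1).add (hA.forces_innerMatched hnd₃.2.1) hnd₂).add
      (hB.forces_innerMatched (Multiset.nodup_add.1 hnd₁).2.1) hnd₁).add
      (hR.forces (Multiset.nodup_add.1 hnd).2.1) hnd).exists_partner e'
  have hv' : v ∈ lp ∨ v ∈ la ∨ v ∈ lb := by
    rw [← Multiset.mem_coe, ← Multiset.mem_coe, ← Multiset.mem_coe, hp, hla, hlb]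
    simp only [Multiset.mem_add] at hv ⊢
    tauto
  rw [← hp, ← hla, ← hlb, Multiset.coe_add, Multiset.coe_add, Multiset.coe_nodup] at hnd₁
  have hpa : a ∈ lp := hlp.mem_ends.1
  have hpb : b ∈ lp := hlp.mem_ends.2
  have hma := hlp.partner_mem (fun x ↦ (hm x).2) hpa
  have hmb := hlp.partner_mem (fun x ↦ (hm x).2) hpb
  have hab : a ≠ b := by
    rintro rfl
    have := hnd₃.1
    rw [show {a} + L + {a} = {a} + ({a} + L) by abel] at this
    exact Multiset.disjoint_left.1 (Multiset.nodup_add.1 this).2.2 (Multiset.mem_singleton_self a)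
      (by simp)
  simp only [List.nodup_append, List.mem_append] at hnd₁
  obtain ⟨p, hps, hpm⟩ := hlp.exists_walk hm (by grind)
  obtain ⟨c₁, hc₁, hb₁⟩ := h1.exists_blossom hm (by grind) (by grind)
  obtain ⟨c₂, hc₂, hb₂⟩ := h2.exists_blossom hm (by grind) (by grind)
  refine ⟨_, isMaximumMatching_of_isPerfectMatching (partnerSubgraph_isPerfectMatching hm),
    .inr ⟨a, b, c₁, c₂, p, ⟨hb₁, hb₂, hpm, ?_, .inl (inf_toSubgraph_eq_bot ?_)⟩, ?_⟩⟩
  · rw [hps, hc₁, hc₂]; grind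
  · rw [hc₁, hc₂]; grind
  · rw [hps, hc₁, hc₂]; grind

-- The links ab and cd are matched including their ends, the other four only in their interiors.
-- Then the cycles a, c, d and b, c, d are blossoms with bases a and b that share exactly the
-- mm-path cd, and ab is the mm-path joining them.
set_option maxHeartbeats 1000000 in
theorem mem_SD_of_tetrahedron {a b c d : V} {ab ac ad bc bd cd : Multiset V}
    (h : Tetra G a b c d ab ac ad bc bd cd)
    (hN : Nice G ({a} + {b} + {c} + {d} + ab + ac + ad + bc + bd + cd)) {v : V}
    (hv : v ∈ {a} + {b} + {c} + {d} + ab + ac + ad + bc + bd + cd) : v ∈ SD G := by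
  obtain ⟨R, hR, e⟩ := hN
  have e' : ({a} + ab + {b}) + ({c} + cd + {d}) + ac + ad + bc + bd + R = Finset.univ.val := by
    rw [← e]; abel
  have hnd := e' ▸ Finset.univ.nodup
  have hnd₁ := (Multiset.nodup_add.1 hnd).1
  have hnd₂ := (Multiset.nodup_add.1 hnd₁).1
  have hnd₃ := (Multiset.nodup_add.1 hnd₂).1
  have hnd₄ := (Multiset.nodup_add.1 hnd₃).1
  have hnd₅ := (Multiset.nodup_add.1 hnd₄).1
  have hnd₆ := Multiset.nodup_add.1 hnd₅
  obtain ⟨m, hm, ⟨⟨⟨⟨⟨⟨lp, hp, hlp⟩, ⟨lq, hq, hlq⟩⟩, ⟨lac, eac, hac⟩⟩, ⟨lad, ead, had⟩⟩,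
      ⟨lbc, ebc, hbc⟩⟩, ⟨lbd, ebd, hbd⟩⟩, -⟩ :=
    (((((((h.ab.forces_fullyMatched hnd₆.1).add (h.cd.forces_fullyMatched hnd₆.2.1) hnd₅).add
      (h.ac.forces_innerMatched (Multiset.nodup_add.1 hnd₄).2.1) hnd₄).add
      (h.ad.forces_innerMatched (Multiset.nodup_add.1 hnd₃).2.1) hnd₃).add
      (h.bc.forces_innerMatched (Multiset.nodup_add.1 hnd₂).2.1) hnd₂).add
      (h.bd.forces_innerMatched (Multiset.nodup_add.1 hnd₁).2.1) hnd₁).add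
      (hR.forces (Multiset.nodup_add.1 hnd).2.1) hnd).exists_partner e'
  have hv' : v ∈ lp ∨ v ∈ lq ∨ v ∈ lac ∨ v ∈ lad ∨ v ∈ lbc ∨ v ∈ lbd := by
    simp only [← Multiset.mem_coe, hp, hq, eac, ead, ebc, ebd]
    simp only [Multiset.mem_add] at hv ⊢
    tauto
  have hab : a ≠ b := by
    rintro rfl
    have := hnd₆.1
    rw [show {a} + ab + {a} = {a} + ({a} + ab) by abel] at this
    exact Multiset.disjoint_left.1 (Multiset.nodup_add.1 this).2.2 (Multiset.mem_singleton_self a)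
      (by simp)
  rw [← hp, ← hq, ← eac, ← ead, ← ebc, ← ebd] at hnd₁
  simp only [Multiset.coe_add, Multiset.coe_nodup] at hnd₁
  have hpa : a ∈ lp := hlp.mem_ends.1
  have hpb : b ∈ lp := hlp.mem_ends.2
  have hma := hlp.partner_mem (fun x ↦ (hm x).2) hpa
  have hmb := hlp.partner_mem (fun x ↦ (hm x).2) hpb
  have had' := had.symm fun x _ ↦ (hm x).2
  have hbd' := hbd.symm fun x _ ↦ (hm x).2
  have hl₁ : (lac ++ lq ++ lad.reverse).Nodup := by
    refine List.Nodup.of_append_left (l₂ := []) ?_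
    simp only [List.nodup_append, List.mem_append, List.mem_reverse, List.nodup_reverse] at hnd₁ ⊢
    grind
  have hl₂ : (lbc ++ lq ++ lbd.reverse).Nodup := by
    simp only [List.nodup_append, List.mem_append, List.mem_reverse, List.nodup_reverse] at hnd₁ ⊢
    grind
  simp only [List.nodup_append, List.mem_append] at hnd₁
  have hpl₁ : ∀ x ∈ lp, x ∉ lac ++ lq ++ lad.reverse := by
    intro x hx; simp only [List.mem_append, List.mem_reverse]; grind
  have hpl₂ : ∀ x ∈ lp, x ∉ lbc ++ lq ++ lbd.reverse := by
    intro x hx; simp only [List.mem_append, List.mem_reverse]; grind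
  obtain ⟨p, hps, hpm⟩ := hlp.exists_walk hm (by grind)
  obtain ⟨q, hqs, hqm⟩ := hlq.exists_walk hm (by grind)
  obtain ⟨c₁, hc₁, hb₁⟩ := (hac.trans hlq had').exists_blossom hm
    (List.nodup_append.2 ⟨hl₁, by simp, by grind⟩) (hpl₁ _ hma)
  obtain ⟨c₂, hc₂, hb₂⟩ := (hbc.trans hlq hbd').exists_blossom hm
    (List.nodup_append.2 ⟨hl₂, by simp, by grind⟩) (hpl₂ _ hmb)
  refine ⟨_, isMaximumMatching_of_isPerfectMatching (partnerSubgraph_isPerfectMatching hm),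
    .inr ⟨a, b, c₁, c₂, p, ⟨hb₁, hb₂, hpm, ?_, .inr ⟨c, d, q, hqm,
      inf_toSubgraph_eq (A := a :: lac) (B := lad.reverse ++ [a]) (A' := b :: lbc)
        (B' := lbd.reverse ++ [b]) (T := lq) (by simp [hc₁]) (by simp [hc₂]) hqs ?_ ?_⟩⟩, ?_⟩⟩
  · rw [hps, hc₁, hc₂]; grind
  · simp only [List.mem_append, List.mem_cons, List.mem_reverse]; grind
  · simp only [List.mem_append, List.mem_cons, List.mem_reverse]; grind
  · rw [hps, hc₁, hc₂]
    simp only [List.mem_append, List.mem_cons, List.mem_reverse]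
    tauto

theorem InPosyShape.mem_SD {v : V} (h : InPosyShape G v) : v ∈ SD G := by
  obtain ⟨S, hS, hN, hv⟩ := h
  cases hS with
  | barbell hA hL hB => exact mem_SD_of_barbell hA hL hB hN hv
  | tetrahedron h1 h2 h3 h4 h5 h6 =>
    exact mem_SD_of_tetrahedron ⟨h1, h2, h3, h4, h5, h6⟩ hN hv

theorem matched_univ_of_isPerfectMatching {M : G.Subgraph} (hM : M.IsPerfectMatching) :
    Matched G Finset.univ.val := by
  choose m hm _ using Subgraph.isPerfectMatching_iff.1 hM
  refine IsPartner.matched (m := m) (fun x _ ↦ ⟨Finset.mem_univ _, (hm x).adj_sub, ?_⟩)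
    Finset.univ.nodup
  exact (hM.1.eq_of_adj_left (hm x).symm (hm (m x))).symm

theorem IsBicritical.isSterboulDeming (hG : IsBicritical G)
    (hM : ∃ M : G.Subgraph, M.IsPerfectMatching) : IsSterboulDeming G := by
  obtain ⟨M, hM⟩ := hM
  rw [IsSterboulDeming, KE, Set.compl_empty_iff, Set.eq_univ_iff_forall]
  exact fun v ↦ (hG.inPosyShape (matched_univ_of_isPerfectMatching hM) v).mem_SD

end Posy

/-! ### Recovering the matched pairs from blossoms and mm-paths. -/

section Alternation

variable {M : G.Subgraph} {m : V → V} (hm : ∀ x y, M.Adj x y ↔ m x = y)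
include hm

theorem IsAlternatingWalk.fullyMatched : ∀ {a b : V} (p : G.Walk a b), IsAlternatingWalk M p →
    (∃ e ∈ p.edges.head?, e ∈ M.edgeSet) → (∃ e ∈ p.edges.getLast?, e ∈ M.edgeSet) →
    FullyMatched G m a p.support b
  | _, _, .nil, _, h, _ => by simp at h
  | _, _, .cons h .nil, _, h', _ => by
    simp only [Walk.edges_cons, List.head?_cons, Option.mem_def, Option.some.injEq,
      exists_eq_left', Subgraph.mem_edgeSet, hm] at h'
    exact .edge h h'
  | _, _, .cons h (.cons h' .nil), h1, h2, h3 => by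
    simp [IsAlternatingWalk] at h1 h2 h3
    exact absurd h1 (by simp [h2, h3])
  | _, _, .cons h (.cons h' (.cons h'' p)), h1, h2, h3 => by
    simp only [IsAlternatingWalk, Walk.edges_cons, List.isChain_cons_cons] at h1
    simp only [Walk.edges_cons, List.head?_cons, Option.mem_def, Option.some.injEq,
      exists_eq_left', List.getLast?_cons_cons] at h2 h3
    have h4 := h1.1.resolve_right (fun h ↦ h.2 h2)
    have h5 := h1.2.1.resolve_left (fun h ↦ h4.2 h.1)
    refine .cons h ((hm _ _).1 h2) h' (fullyMatched (.cons h'' p) h1.2.2 ⟨_, rfl, h5.1⟩ ?_)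
    simpa using h3

open Classical in
-- No two edges at a vertex are matched and no matched edge meets b, so each matched edge is
-- followed by an unmatched one. Equality in the count forces strict alternation starting with a
-- matched edge.
theorem innerMatched_of_isPath : ∀ {x b : V} (p : G.Walk x b), p.IsPath →
    (∀ e ∈ p.edges, b ∈ e → e ∉ M.edgeSet) →
    2 * p.edges.countP (· ∈ M.edgeSet) ≤ p.length ∧
      (2 * p.edges.countP (· ∈ M.edgeSet) = p.length →
        ∀ a, G.Adj a x → ∃ l, p.support = l ++ [b] ∧ InnerMatched G m a l b)
  | x, _, .nil, _, _ => ⟨by simp, fun _ a ha ↦ ⟨[], by simp, .edge ha⟩⟩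
  | x, b, .cons (v := y) h p, hp, hb => by
    by_cases hM : s(x, y) ∈ M.edgeSet
    · match p with
      | .nil => exact absurd hM (hb _ (by simp) (by simp))
      | .cons (v := z) h' p =>
        have hz : s(y, z) ∉ M.edgeSet := by
          intro h1
          have h2 := (hm _ _).1 (Subgraph.mem_edgeSet.1 hM).symm
          have h3 := (hm _ _).1 (Subgraph.mem_edgeSet.1 h1)
          have : x = z := h2.symm.trans h3
          subst this
          simp at hp
        obtain ⟨h1, h2⟩ := innerMatched_of_isPath p hp.of_cons.of_cons
          fun e he ↦ hb e (by simp [he])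
        simp only [Walk.edges_cons, List.countP_cons, hM, hz, Walk.length_cons, decide_true,
          decide_false, if_true]
        simp only [Bool.false_eq_true, if_false]
        refine ⟨by omega, fun h3 a ha ↦ ?_⟩
        obtain ⟨l, h4, h5⟩ := h2 (by omega) y h'
        exact ⟨x :: y :: l, by simp [h4], .cons ha h ((hm _ _).1 hM) h5⟩
    · have := (innerMatched_of_isPath p hp.of_cons fun e he ↦ hb e (by simp [he])).1
      simp only [Walk.edges_cons, List.countP_cons, hM, Walk.length_cons,
          decide_false, Bool.false_eq_true, if_false]
      exact ⟨by omega, by omega⟩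

theorem IsBlossom.innerMatched {b : V} {c : G.Walk b b} (hc : IsBlossom M c) :
    ∃ l, c.support = b :: (l ++ [b]) ∧ InnerMatched G m b l b := by
  classical
  obtain ⟨h1, ⟨k, h2, h3⟩, h4⟩ := hc
  cases c with
  | nil => simp at h1
  | @cons _ y _ h p =>
    have hp := (Walk.cons_isCycle_iff p h).1 h1
    obtain ⟨h5, h6⟩ := innerMatched_of_isPath hm p hp.1 fun e he ↦ h4 e (by simp [he])
    have h7 := h4 s(b, y) (by simp) (by simp)
    have h8 : k ≤ p.edges.countP (· ∈ M.edgeSet) := by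
      rw [← h3, List.countP_eq_length_filter]
      refine le_trans ?_ (List.toFinset_card_le _)
      rw [← Set.ncard_coe_finset]
      apply Set.ncard_le_ncard _ (Finset.finite_toSet _)
      rintro e ⟨h8, h9⟩
      rw [Walk.edges_cons, List.mem_cons] at h8
      rcases h8 with rfl | h8
      · exact absurd h9 h7
      · simpa using ⟨h8, h9⟩
    rw [Walk.length_cons] at h2
    obtain ⟨l, h9, h10⟩ := h6 (by omega) b h
    exact ⟨l, by simp [h9], h10⟩

end Alternation

/-! ### A set containing the partner of each of its neighbours avoids all posies. -/

section Propagation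

variable {m : V → V} {I : Set V} (hI : ∀ y ∈ I, ∀ z, G.Adj y z → m z ∈ I) {a b v : V} {l : List V}
include hI

theorem InnerMatched.partner_mem_of_mem (h : InnerMatched G m a l b) (ha : a ∈ I) : m b ∈ I := by
  induction h with
  | edge h => exact hI _ ha _ h
  | cons h1 _ h3 _ ih => exact ih (h3 ▸ hI _ ha _ h1)

theorem InnerMatched.partner_mem (hm : ∀ x, m (m x) = x) (h : InnerMatched G m a l b)
    (hv : v ∈ l) (hvI : v ∈ I) : m a ∈ I ∨ m b ∈ I := by
  induction h with
  | edge => simp at hv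
  | @cons a x y b l h1 h2 h3 h4 ih =>
    rw [List.mem_cons, List.mem_cons] at hv
    rcases hv with rfl | rfl | hv
    · exact .inl (hI _ hvI _ h1.symm)
    · exact .inr (h4.partner_mem_of_mem hI hvI)
    · refine (ih hv).imp_left fun h ↦ hI _ h _ ?_
      rw [← h3, hm]
      exact h1.symm

theorem FullyMatched.right_mem (h : FullyMatched G m a l b) (ha : m a ∈ I) : b ∈ I := by
  induction h with
  | edge _ h => exact h ▸ ha
  | cons _ h2 h3 _ ih => exact ih (hI _ ha _ (h2 ▸ h3))

theorem FullyMatched.left_mem (hm : ∀ x, m (m x) = x) (h : FullyMatched G m a l b)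
    (hb : m b ∈ I) : a ∈ I := by
  induction h with
  | edge _ h => rwa [← h, hm] at hb
  | @cons a x y b l _ h2 h3 _ ih =>
    rw [← hm a, h2]
    exact hI _ (ih hb) _ h3.symm

theorem FullyMatched.mem (hm : ∀ x, m (m x) = x) (h : FullyMatched G m a l b)
    (hv : v ∈ l) (hvI : v ∈ I) : a ∈ I ∨ b ∈ I := by
  induction h with
  | edge =>
    simp only [List.mem_cons, List.not_mem_nil, or_false] at hv
    rcases hv with rfl | rfl
    exacts [.inl hvI, .inr hvI]
  | @cons a x y b l h1 h2 h3 h4 ih =>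
    rw [List.mem_cons, List.mem_cons] at hv
    rcases hv with rfl | rfl | hv
    · exact .inl hvI
    · exact .inr (h4.right_mem hI (hI _ hvI _ h3))
    · refine (ih hv).imp_left fun h ↦ ?_
      rw [← hm a, h2]
      exact hI _ h _ h3.symm

end Propagation

/-- Going round a blossom from its base b ∈ I would put the partner of b in I, although the two are
adjacent; so bases are not in I. Along the mm-path, a base's partner in I would put the other base
in I. Any other vertex of the posy in I leads to one of these cases. -/
theorem not_mem_of_isPosy {M : G.Subgraph} {m : V → V} (hM : ∀ x y, M.Adj x y ↔ m x = y)
    {I : Set V} (hI : ∀ y ∈ I, ∀ z, G.Adj y z → m z ∈ I) (hI' : ∀ x ∈ I, ∀ y ∈ I, ¬ G.Adj x y)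
    {b₁ b₂ v : V} {c₁ : G.Walk b₁ b₁} {c₂ : G.Walk b₂ b₂} {p : G.Walk b₁ b₂}
    (h : IsPosy M c₁ c₂ p) (hv : v ∈ c₁.support ∨ v ∈ c₂.support ∨ v ∈ p.support) : v ∉ I := by
  intro hvI
  have hadj (x : V) : M.Adj x (m x) := (hM x _).2 rfl
  have hm (x : V) : m (m x) = x := (hM _ _).1 (hadj x).symm
  obtain ⟨h1, h2, h3, -, -⟩ := h
  obtain ⟨l₁, e₁, h₁⟩ := h1.innerMatched hM
  obtain ⟨l₂, e₂, h₂⟩ := h2.innerMatched hM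
  have hp := IsAlternatingWalk.fullyMatched hM p h3.2.1 h3.2.2.1 h3.2.2.2
  have n₁ : b₁ ∉ I := fun h ↦ hI' _ h _ (h₁.partner_mem_of_mem hI h) (hadj _).adj_sub
  have n₂ : b₂ ∉ I := fun h ↦ hI' _ h _ (h₂.partner_mem_of_mem hI h) (hadj _).adj_sub
  have n₁' : m b₁ ∉ I := fun h ↦ n₂ (hp.right_mem hI h)
  have n₂' : m b₂ ∉ I := fun h ↦ n₁ (hp.left_mem hI hm h)
  have key {b : V} {l : List V} (n : b ∉ I) (n' : m b ∉ I) (hl : InnerMatched G m b l b)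
      (hv : v ∈ b :: (l ++ [b])) : False := by
    have hv' : v = b ∨ v ∈ l := by
      simp only [List.mem_cons, List.mem_append, List.not_mem_nil, or_false] at hv
      tauto
    rcases hv' with rfl | hv'
    · exact n hvI
    · exact (hl.partner_mem hI hm hv' hvI).elim n' n'
  rcases hv with hv | hv | hv
  · exact key n₁ n₁' h₁ (e₁ ▸ hv)
  · exact key n₂ n₂' h₂ (e₂ ▸ hv)
  · exact (hp.mem hI hm hv hvI).elim n₁ n₂

theorem IsSterboulDeming.isBicritical [Fintype V] (hG : IsSterboulDeming G)
    (hM : ∃ M : G.Subgraph, M.IsPerfectMatching) : IsBicritical G := by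
  classical
  rintro I ⟨v, hv⟩ hI N hN
  by_contra! hlt
  have hvSD : v ∈ SD G := by
    rw [IsSterboulDeming, KE, Set.compl_empty_iff] at hG
    simp [hG]
  obtain ⟨M, hMm, h⟩ := hvSD
  have hMp := hMm.isPerfectMatching hM
  choose m hm hm' using Subgraph.isPerfectMatching_iff.1 hMp
  have hadj (x y : V) : M.Adj x y ↔ m x = y := ⟨fun h ↦ (hm' x y h).symm, fun h ↦ h ▸ hm x⟩
  have hmm (x : V) : m (m x) = x := (hadj _ _).1 (hm x).symm
  -- The matching injects I into N, and N is no larger.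
  have himg : I.image m = N := by
    apply Finset.eq_of_subset_of_card_le
    · exact Finset.image_subset_iff.2 fun x hx ↦ hN x hx _ (hm x).adj_sub
    · rwa [Finset.card_image_of_injective _ (Function.LeftInverse.injective hmm)]
  have hcl : ∀ y ∈ (I : Set V), ∀ z, G.Adj y z → m z ∈ (I : Set V) := by
    intro y hy z hz
    have := hN y hy z hz
    rw [← himg, Finset.mem_image] at this
    obtain ⟨x, hx, rfl⟩ := this
    rw [hmm]
    exact hx
  rcases h with ⟨b, r, c, p, h, -⟩ | ⟨b₁, b₂, c₁, c₂, p, h, h'⟩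
  · exact h.2.2.2.2.1 ⟨_, hm r⟩
  · exact not_mem_of_isPosy hadj hcl hI h h' hv

/-! ### Sachs subgraphs as injective maps to neighbours. -/

section SachsSubgraph

open Function

variable {W : Type*} {G S : SimpleGraph W}

theorem cycleGraph_adj_add_one (n : ℕ) (i : Fin (n + 2)) : (cycleGraph (n + 2)).Adj i (i + 1) := by
  simp [cycleGraph_adj]

/-- K₂ counts as the cycle on two vertices; f takes one step round each component. -/
theorem IsSachsSubgraph.exists_injective (h : IsSachsSubgraph G S) :
    ∃ f : W → W, Injective f ∧ ∀ x, G.Adj x (f x) := by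
  have key (C : S.ConnectedComponent) :
      ∃ g : C → C, Injective g ∧ ∀ x : C, S.Adj x (g x) := by
    obtain ⟨n, ⟨e⟩⟩ : ∃ n, Nonempty (C.toSimpleGraph ≃g cycleGraph (n + 2)) := by
      rcases h.2 C with ⟨⟨e⟩⟩ | ⟨n, hn, ⟨e⟩⟩
      · exact ⟨0, by rw [zero_add, cycleGraph_two_eq_top]; exact ⟨e⟩⟩
      · obtain ⟨k, rfl⟩ := Nat.exists_eq_add_of_le' hn
        exact ⟨k + 1, ⟨e⟩⟩
    refine ⟨fun x ↦ e.symm (e x + 1), fun x y hxy ↦ ?_, fun x ↦ ?_⟩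
    · simpa using hxy
    · have := e.symm.map_adj_iff.2 (cycleGraph_adj_add_one n (e x))
      rw [e.symm_apply_apply] at this
      exact this
  choose g hg hg' using key
  have hadj (x : W) := hg' (S.connectedComponentMk x) ⟨x, rfl⟩
  refine ⟨fun x ↦ g (S.connectedComponentMk x) ⟨x, rfl⟩, fun x y hxy ↦ ?_, fun x ↦ h.1 (hadj x)⟩
  have hC : S.connectedComponentMk x = S.connectedComponentMk y := by
    rw [ConnectedComponent.connectedComponentMk_eq_of_adj (hadj x),
      ConnectedComponent.connectedComponentMk_eq_of_adj (hadj y)]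
    exact congrArg _ hxy
  have heq (C : S.ConnectedComponent) (h : S.connectedComponentMk x = C) :
      (g (S.connectedComponentMk x) ⟨x, rfl⟩ : W) = g C ⟨x, h⟩ := by
    subst h
    rfl
  exact congrArg Subtype.val (hg _ (Subtype.ext ((heq _ hC).symm.trans hxy)))

/-- The graph joining each vertex with its image under `f`. -/
def functionalGraph (f : W → W) : SimpleGraph W := .fromRel fun x y ↦ f x = y

variable [Finite W] {f : W → W} (hf : Injective f) (hf' : ∀ x, G.Adj x (f x))
include hf hf'

omit [Finite W] hf in
theorem functionalGraph_adj {x y : W} : (functionalGraph f).Adj x y ↔ f x = y ∨ f y = x := by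
  rw [functionalGraph, fromRel_adj, and_iff_right_iff_imp]
  rintro (rfl | rfl)
  · exact (hf' x).ne
  · exact (hf' y).ne'

/-- An injective map of a finite set is a permutation and the components are its orbits. There are
no fixed points, so each period is at least 2, with period 2 giving K₂. -/
theorem functionalGraph_nonempty_iso (C : (functionalGraph f).ConnectedComponent) :
    ∃ n, Nonempty (C.toSimpleGraph ≃g cycleGraph (n + 2)) := by
  obtain ⟨x, rfl⟩ := C.exists_rep
  have hp : x ∈ periodicPts f := hf.mem_periodicPts x
  have h0 : 0 < minimalPeriod f x := minimalPeriod_pos_of_mem_periodicPts hp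
  have h1 : minimalPeriod f x ≠ 1 := fun h ↦ by
    rw [minimalPeriod_eq_one_iff_isFixedPt] at h
    exact (hf' x).ne' h
  obtain ⟨n, hn⟩ : ∃ n, minimalPeriod f x = n + 2 := ⟨minimalPeriod f x - 2, by omega⟩
  have hadj (y : W) : (functionalGraph f).Adj y (f y) := (functionalGraph_adj hf').2 (.inl rfl)
  have hreach (k : ℕ) : (functionalGraph f).Reachable (f^[k] x) x := by
    induction k with
    | zero => rfl
    | succ k ih =>
      rw [iterate_succ_apply']
      exact (hadj _).symm.reachable.trans ih
  have hmod (k : ℕ) : f^[k % (n + 2)] x = f^[k] x := hn ▸ iterate_mod_minimalPeriod_eq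
  let e (i : Fin (n + 2)) : W := f^[(i : ℕ)] x
  have he : Injective e := fun i j hij ↦ Fin.ext <| iterate_injOn_Iio_minimalPeriod
    (by rw [hn]; exact i.2) (by rw [hn]; exact j.2) hij
  have hsucc (i : Fin (n + 2)) : f (e i) = e (i + 1) := by
    simp only [e, Fin.val_add, Fin.val_one, hmod, iterate_succ_apply']
  have hsurj (y : W) (hy : (functionalGraph f).Reachable y x) : ∃ i, e i = y := by
    obtain ⟨p⟩ := hy
    induction p with
    | nil => exact ⟨0, rfl⟩
    | cons h _ ih =>
      obtain ⟨i, rfl⟩ := ih hp h0 h1 hn hreach hmod he hsucc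
      rcases (functionalGraph_adj hf').1 h with h | h
      · refine ⟨i - 1, hf ?_⟩
        rw [hsucc, h, sub_add_cancel]
      · exact ⟨i + 1, by rw [← h, hsucc]⟩
  let E : Fin (n + 2) → (functionalGraph f).connectedComponentMk x := fun i ↦
    ⟨e i, ConnectedComponent.eq.2 (hreach _)⟩
  have hE : Bijective E := by
    refine ⟨fun i j hij ↦ he (congrArg Subtype.val hij), fun ⟨y, hy⟩ ↦ ?_⟩
    obtain ⟨i, hi⟩ := hsurj y (ConnectedComponent.eq.1 hy)
    exact ⟨i, Subtype.ext hi⟩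
  refine ⟨n, ⟨Iso.symm ⟨Equiv.ofBijective E hE, fun {i j} ↦ ?_⟩⟩⟩
  change (functionalGraph f).Adj (e i) (e j) ↔ _
  rw [functionalGraph_adj hf', hsucc, hsucc, he.eq_iff, he.eq_iff, cycleGraph_adj,
    sub_eq_iff_eq_add', sub_eq_iff_eq_add', or_comm, eq_comm, @eq_comm _ (i + 1)]

theorem isSachsSubgraph_functionalGraph : IsSachsSubgraph G (functionalGraph f) := by
  refine ⟨fun x y h ↦ ?_, fun C ↦ ?_⟩
  · rcases (functionalGraph_adj hf').1 h with rfl | rfl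
    exacts [hf' _, (hf' _).symm]
  · obtain ⟨n, h⟩ := functionalGraph_nonempty_iso hf hf' C
    cases n with
    | zero =>
      rw [zero_add, cycleGraph_two_eq_top] at h
      exact .inl h
    | succ n => exact .inr ⟨n + 3, by omega, h⟩

end SachsSubgraph

/-! ### The criterion and 1-Sachs criticality. -/

theorem IsSachsCritical.isBicritical [Fintype V] (hG : IsSachsCritical 1 G)
    (hM : ∃ M : G.Subgraph, M.IsPerfectMatching) : IsBicritical G := by
  classical
  obtain ⟨M, hM⟩ := hM
  rintro I ⟨u, hu⟩ hI N hN
  obtain ⟨v, huv, -⟩ := Subgraph.isPerfectMatching_iff.1 hM u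
  have huv := huv.adj_sub
  -- Deleting the neighbour v of u removes nothing from the independent set I but one vertex from N,
  -- and the rest of N must still receive I injectively.
  obtain ⟨H, hH⟩ := hG {v} (Finset.card_singleton v)
  obtain ⟨f, hf, hf'⟩ := hH.exists_injective
  have hv (x : V) (hx : x ∈ I) : x ∈ ((({v} : Finset V) : Set V)ᶜ : Set V) := by
    simp only [Finset.coe_singleton, Set.mem_compl_iff, Set.mem_singleton_iff]
    rintro rfl
    exact hI _ hu _ hx huv
  have hvN : v ∈ N := hN u hu v huv
  have : I.card ≤ (N.erase v).card := by
    rw [← I.card_attach]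
    refine Finset.card_le_card_of_injOn (fun x ↦ f ⟨x.1, hv _ x.2⟩) (fun x _ ↦ ?_) ?_
    · exact Finset.mem_coe.2 (Finset.mem_erase.2 ⟨fun h ↦
        (f ⟨x.1, hv _ x.2⟩).2 (Finset.mem_coe.2 (Finset.mem_singleton.2 h)),
        hN _ x.2 _ (hf' ⟨x.1, hv _ x.2⟩)⟩)
    · intro x _ y _ hxy
      have := hf (Subtype.ext hxy)
      exact Subtype.ext (Subtype.mk.inj this)
  have := Finset.card_erase_lt_of_mem hvN
  omega

theorem IsBicritical.isSachsCritical [Fintype V] (hG : IsBicritical G) : IsSachsCritical 1 G := by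
  classical
  intro S hS
  obtain ⟨v, rfl⟩ := Finset.card_eq_one.1 hS
  set W : Set V := ((({v} : Finset V) : Set V)ᶜ : Set V) with hW
  have hmem (x : V) : x ∈ W ↔ x ≠ v := by simp [hW]
  suffices ∃ f : W → W, Function.Injective f ∧
      ∀ x, f x ∈ (Finset.univ.filter ((G.induce W).Adj x)) by
    obtain ⟨f, hf, hf'⟩ := this
    exact ⟨_, isSachsSubgraph_functionalGraph hf fun x ↦ by simpa using hf' x⟩
  rw [← Finset.all_card_le_biUnion_card_iff_exists_injective]
  intro X
  by_contra! hlt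
  set Y := X.biUnion fun x ↦ Finset.univ.filter ((G.induce W).Adj x)
  let X' := X.map (Function.Embedding.subtype _)
  let Y' := Y.map (Function.Embedding.subtype _)
  have hlt' : Y'.card < X'.card := by simpa [X', Y'] using hlt
  have hv (x : V) (hx : x ∈ X') : x ≠ v := by
    obtain ⟨y, -, rfl⟩ := Finset.mem_map.1 hx
    exact (hmem _).1 y.2
  have hY (x : V) (hx : x ∈ X') (y : V) (hxy : G.Adj x y) (hy : y ≠ v) : y ∈ Y' := by
    obtain ⟨z, hz, rfl⟩ := Finset.mem_map.1 hx
    refine Finset.mem_map.2 ⟨⟨y, (hmem y).2 hy⟩, ?_, rfl⟩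
    exact Finset.mem_biUnion.2 ⟨z, hz, by simpa using hxy⟩
  -- With Y' the neighbourhood of X' in G - v, the set X' \ Y' is independent and its neighbours lie
  -- in Y' \ X' together with v. Removing the common part keeps |Y' \ X'| < |X' \ Y'|, so even with
  -- v there are too few.
  have h1 := Finset.card_sdiff_add_card_inter X' Y'
  have h2 := Finset.card_sdiff_add_card_inter Y' X'
  rw [Finset.inter_comm] at h2
  have h3 := hG (X' \ Y') (Finset.card_pos.1 (by omega)) (fun x hx y hy hxy ↦ by
    rw [Finset.mem_sdiff] at hx hy
    exact hy.2 (hY x hx.1 y hxy (hv y hy.1))) (insert v (Y' \ X')) fun x hx y hxy ↦ by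
    rw [Finset.mem_sdiff] at hx
    rw [Finset.mem_insert, Finset.mem_sdiff, or_iff_not_imp_left]
    exact fun hy ↦ ⟨hY x hx.1 y hxy hy, fun hy' ↦ hx.2 (hY y hy' x hxy.symm (hv x hx.1))⟩
  have h4 := Finset.card_insert_le v (Y' \ X')
  omega

end SterboulDeming

theorem mainTheorem3 {V : Type*} [Finite V] (G : SimpleGraph V)
    (hG : ∃ M : G.Subgraph, M.IsPerfectMatching) :
    SterboulDeming.IsSterboulDeming G ↔ SterboulDeming.IsSachsCritical 1 G := by
  have := Fintype.ofFinite V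
  exact ⟨fun h ↦ (h.isBicritical hG).isSachsCritical,
    fun h ↦ (h.isBicritical hG).isSterboulDeming hG⟩
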